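/- **Theorem 4.1.** A stretched coupled-task $t$ with stretch factor $\alpha(t)\in\mathbb N$, $\alpha(t)\ge 1$, consists of two sub-tasks of length $\alpha(t)$ separated by an idle time of length exactly $\alpha(t)$. In the problem $1|\alpha(t_i),G=\text{star}|C_{max}$ one is given a finite set $\mathcal T=\{\beta,s_1,\dots,s_n\}$ of such tasks, whose compatibility graph $G$ is the star with central node $\beta$ and satellites $s_1,\dots,s_n$. A feasible schedule assigns to each task a real start time $\ge 0$ such that a single processor executes at most one sub-task at a time, and such that two tasks not adjacent in $G$ are executed one after the other (a compatible task may use the idle time of the other). The objective is to minimize the completion time $C_{max}$ of the latest task. 1. This problem admits an FPTAS: there is one random access machine program (with addition and subtraction at unit cost) which, given an instance $I$ and a rational number $\epsilon=p/q>0$, with all numbers in binary, outputs a feasible schedule of length at most $(1+\epsilon)\,OPT(I)$, in a number of steps polynomial in the size of $I$ and in $1/\epsilon$. 2. Put $seq(X)=\sum_{t\in X}3\alpha(t)$. Suppose that the central node has only incoming arcs, where each edge is directed from the smaller to the larger stretch factor, and in both directions if they are equal; that is, $\alpha(s_i)<\alpha(\beta)$ for all $i$. Consider the optimization version of Subset Sum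 in which the items are the satellites, with values $3\alpha(s_i)$, and the capacity is $\alpha(\beta)$. Then every feasible set $W$ of items, in particular an optimal one $W^*$, satisfies $seq(\mathcal T)\ge 3\,seq(W)$. If $\epsilon\ge 0$ is real and $W$ is a feasible set with $seq(W)\ge(1-\epsilon)\,seq(W^*)$, then there is a feasible schedule in which exactly the tasks of $W$ are executed within the idle time of $\beta$; its length is $seq(\mathcal T)-seq(W)$, and this is at most $(1+\epsilon/2)\,OPT(I)$. -/

import Mathlib

/-! ## Random access machines with unit cost -/

namespace RAM

/-- Programs of a random access machine, in structured form.  A program uses finitely many registers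
and finitely many arrays (both named by numerals), whose cells hold natural numbers.  The only
arithmetic is addition and truncated subtraction: one step lengthens the longest number in the
machine by at most one bit, so the number of steps is polynomially related to the time of a Turing
machine. -/
inductive Program : Type
  /-- do nothing -/
  | skip : Program
  /-- `const r k`: register `r` becomes the constant `k` -/
  | const (r k : ℕ) : Program
  /-- `add r x y`: register `r` becomes the sum of registers `x` and `y` -/
  | add (r x y : ℕ) : Program
  /-- `sub r x y`: register `r` becomes the truncated difference of registers `x` and `y` -/
  | sub (r x y : ℕ) : Program
  /-- `load r a x`: register `r` becomes the cell of array `a` whose index is in register `x` -/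
  | load (r a x : ℕ) : Program
  /-- `store a x y`: the cell of array `a` whose index is in register `x` becomes the content of
  register `y` -/
  | store (a x y : ℕ) : Program
  /-- sequential composition -/
  | seq (P Q : Program) : Program
  /-- `ifPos x P Q`: if register `x` is positive then `P` else `Q` -/
  | ifPos (x : ℕ) (P Q : Program) : Program
  /-- `loop x P`: as long as register `x` is positive, execute `P` -/
  | loop (x : ℕ) (P : Program) : Program

/-- The content of the registers and of the arrays. -/
structure State where
  /-- the content of each register -/
  reg : ℕ → ℕ
  /-- `arr a i` is the content of cell `i` of array `a` -/
  arr : ℕ → ℕ → ℕ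

/-- The state `s` with register `r` set to `v`. -/
def State.setReg (s : State) (r v : ℕ) : State :=
  ⟨Function.update s.reg r v, s.arr⟩

/-- The state `s` with cell `i` of array `a` set to `v`. -/
def State.setArr (s : State) (a i v : ℕ) : State :=
  ⟨s.reg, Function.update s.arr a (Function.update (s.arr a) i v)⟩

/-- `Exec P s s' t`: started in state `s`, the program `P` halts in state `s'` after exactly `t`
steps.  Every elementary instruction and every test of a condition is one step. -/
inductive Exec : Program → State → State → ℕ → Prop
  | skip (s : State) : Exec .skip s s 1
  | const (s : State) (r k : ℕ) : Exec (.const r k) s (s.setReg r k) 1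
  | add (s : State) (r x y : ℕ) : Exec (.add r x y) s (s.setReg r (s.reg x + s.reg y)) 1
  | sub (s : State) (r x y : ℕ) : Exec (.sub r x y) s (s.setReg r (s.reg x - s.reg y)) 1
  | load (s : State) (r a x : ℕ) : Exec (.load r a x) s (s.setReg r (s.arr a (s.reg x))) 1
  | store (s : State) (a x y : ℕ) : Exec (.store a x y) s (s.setArr a (s.reg x) (s.reg y)) 1
  | seq {P Q : Program} {s s' s'' : State} {t t' : ℕ} :
      Exec P s s' t → Exec Q s' s'' t' → Exec (.seq P Q) s s'' (t + t')
  | ifPos_pos {x : ℕ} {P Q : Program} {s s' : State} {t : ℕ} :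
      0 < s.reg x → Exec P s s' t → Exec (.ifPos x P Q) s s' (t + 1)
  | ifPos_zero {x : ℕ} {P Q : Program} {s s' : State} {t : ℕ} :
      s.reg x = 0 → Exec Q s s' t → Exec (.ifPos x P Q) s s' (t + 1)
  | loop_pos {x : ℕ} {P : Program} {s s' s'' : State} {t t' : ℕ} :
      0 < s.reg x → Exec P s s' t → Exec (.loop x P) s' s'' t' →
        Exec (.loop x P) s s'' (t + t' + 1)
  | loop_zero {x : ℕ} {P : Program} {s : State} :
      s.reg x = 0 → Exec (.loop x P) s s 1

/-- The initial state on the input `w`: the input stands in array `0`, and every other cell and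
every register is `0`. -/
def initial (w : List ℕ) : State :=
  ⟨fun _ => 0, fun a i => if a = 0 then w.getD i 0 else 0⟩

/-- The output is read from array `1`. -/
def State.output (s : State) : ℕ → ℕ := s.arr 1

/-- The length of an input in binary, with one separator after each number. -/
def bitLength (w : List ℕ) : ℕ := (w.map fun x => x.size + 1).sum

end RAM

/-! ## Minimization problems and fully polynomial-time approximation schemes -/

/-- A minimization problem whose instances are encoded by lists of natural numbers and whose
solutions can be written by a random access machine into its output array. -/
structure MinimizationProblem where
  /-- the instances -/
  Instance : Type
  /-- the encoding of an instance; its size is the binary length of this list -/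
  encode : Instance → List ℕ
  /-- different instances have different encodings -/
  encode_injective : Function.Injective encode
  /-- candidate solutions of an instance -/
  Solution : Instance → Type
  /-- the candidates that are feasible -/
  Feasible : (I : Instance) → Solution I → Prop
  /-- the objective to be minimized over the feasible solutions -/
  cost : (I : Instance) → Solution I → ℝ
  /-- how the content of an output array is read as a candidate solution -/
  decode : (I : Instance) → (ℕ → ℕ) → Solution I

/-- `S` is feasible and costs at most `ρ` times the infimum of the costs of feasible solutions. -/
def MinimizationProblem.IsApprox (M : MinimizationProblem) (ρ : ℝ) (I : M.Instance)
    (S : M.Solution I) : Prop :=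
  M.Feasible I S ∧ ∀ S', M.Feasible I S' → M.cost I S ≤ ρ * M.cost I S'

/-- A fully polynomial-time approximation scheme: one program which, given a rational number
`ε = p / q > 0` (through `p` and `q`) and an instance `I`, halts with a `(1 + ε)`-approximate
solution of `I` after a number of steps that is polynomial in the size of `I` and in `1 / ε`. -/
def MinimizationProblem.AdmitsFPTAS (M : MinimizationProblem) : Prop :=
  ∃ (P : RAM.Program) (C d : ℕ), ∀ (I : M.Instance) (p q : ℕ), 0 < p → 0 < q →
    ∃ (s : RAM.State) (t : ℕ),
      RAM.Exec P (RAM.initial (p :: q :: M.encode I)) s t ∧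
      (t : ℝ) ≤ C * ((RAM.bitLength (M.encode I) : ℝ) + (q : ℝ) / p) ^ d ∧
      M.IsApprox (1 + (p : ℝ) / q) I (M.decode I s.output)

/-! ## Scheduling stretched coupled-tasks under compatibility constraints

Tasks are the elements of a finite type `T`.  The task `t` has the stretch factor `α t`: it consists
of two sub-tasks of length `α t` separated by an idle time of length exactly `α t`.  A schedule is
given by the start times `σ : T → ℝ`. -/

namespace CoupledTask

variable {T : Type*}

/-- The time interval between the start and the completion of task `t`. -/
def span (α : T → ℕ) (σ : T → ℝ) (t : T) : Set ℝ := Set.Ico (σ t) (σ t + 3 * α t)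

/-- The idle time of task `t`, between its two sub-tasks. -/
def idle (α : T → ℕ) (σ : T → ℝ) (t : T) : Set ℝ := Set.Ico (σ t + α t) (σ t + 2 * α t)

/-- The time during which the processor executes one of the two sub-tasks of `t`. -/
def busy (α : T → ℕ) (σ : T → ℝ) (t : T) : Set ℝ :=
  Set.Ico (σ t) (σ t + α t) ∪ Set.Ico (σ t + 2 * α t) (σ t + 3 * α t)

/-- Feasibility on one processor with compatibility graph `G`: no task starts before time `0`, the
processor executes at most one sub-task at a time, and two tasks that are not compatible are
executed one after the other. -/
def Feasible (G : SimpleGraph T) (α : T → ℕ) (σ : T → ℝ) : Prop :=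
  (∀ t, 0 ≤ σ t) ∧
  (∀ t u, t ≠ u → Disjoint (busy α σ t) (busy α σ u)) ∧
  (∀ t u, t ≠ u → ¬ G.Adj t u → Disjoint (span α σ t) (span α σ u))

/-- The schedule length: the completion time of the latest task. -/
noncomputable def makespan (α : T → ℕ) (σ : T → ℝ) : ℝ := ⨆ t, (σ t + 3 * α t)

/-- The time needed to execute the tasks of `W` sequentially. -/
def seq (α : T → ℕ) (W : Finset T) : ℕ := ∑ t ∈ W, 3 * α t

/-- `σ` is feasible and at most `ρ` times as long as any feasible schedule. -/
def IsApproxSchedule (G : SimpleGraph T) (α : T → ℕ) (ρ : ℝ) (σ : T → ℝ) : Prop :=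
  Feasible G α σ ∧ ∀ τ, Feasible G α τ → makespan α σ ≤ ρ * makespan α τ

/-- An instance whose compatibility graph is a star: the central task is `0`, and the satellite tasks
are `1, …, n`.  Processing times are positive. -/
structure StarInstance where
  /-- the number of satellites -/
  n : ℕ
  /-- the stretch factors -/
  α : Fin (n + 1) → ℕ
  /-- stretch factors are positive -/
  pos : ∀ t, 0 < α t

/-- The number of satellites, followed by the stretch factors, the central task first. -/
def StarInstance.encode (I : StarInstance) : List ℕ := I.n :: List.ofFn I.α

theorem StarInstance.encode_injective : Function.Injective StarInstance.encode := by
  rintro ⟨n, α, hα⟩ ⟨m, β, hβ⟩ h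
  simp only [StarInstance.encode, List.cons.injEq] at h
  obtain ⟨rfl, h⟩ := h
  obtain rfl := List.ofFn_injective h
  rfl

/-- The scheduling problem `1 | α(t_i), G = star | C_max`.  A solution assigns to each task a real
start time; cell `t` of the output array is the start time of task `t`. -/
noncomputable def starProblem : MinimizationProblem where
  Instance := StarInstance
  encode := StarInstance.encode
  encode_injective := StarInstance.encode_injective
  Solution I := Fin (I.n + 1) → ℝ
  Feasible I σ := Feasible (SimpleGraph.starGraph 0) I.α σ
  cost I σ := makespan I.α σ
  decode _ out := fun t => (out t : ℝ)

/-- In the orientation of the star from smaller to larger stretch factors (with an edge between equal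
stretch factors in both directions), the central node has only incoming arcs. -/
def StarInstance.OnlyIncoming (I : StarInstance) : Prop :=
  ∀ t, t ≠ 0 → I.α t < I.α 0

end CoupledTask

/-! ## Optimization version of Subset Sum -/

namespace SubsetSum

variable {ι : Type*}

/-- The items of `W` are chosen from `S`, and their values add up to at most the capacity `v`. -/
def Feasible (S : Finset ι) (w : ι → ℕ) (v : ℕ) (W : Finset ι) : Prop :=
  W ⊆ S ∧ ∑ i ∈ W, w i ≤ v

/-- `W` is feasible, and its value is at least `ρ` times the maximal value of a feasible set. -/
def IsApprox (S : Finset ι) (w : ι → ℕ) (v : ℕ) (ρ : ℝ) (W : Finset ι) : Prop :=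
  Feasible S w v W ∧
    ∀ W', Feasible S w v W' → ρ * ((∑ i ∈ W', w i : ℕ) : ℝ) ≤ ((∑ i ∈ W, w i : ℕ) : ℝ)

end SubsetSum

/-! Write `a` for the stretch factor of the central task. Satellites are pairwise incompatible, so
their spans are disjoint, and a schedule can beat the sequential length only by overlapping the
central task with satellites. Two coupled tasks share the processor in few ways
(`cases_of_busy_disjoint`): one after the other, one inside the idle time of the other, or, with
equal stretch factors, interleaved with a shift of one sub-task. Hence (`Feasible.lower_bound`) a
schedule saves at most `3 * a`, with some satellite of stretch factor at least `3 * a`; or at most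
`2 * a`, with some satellite of stretch factor `a`; or at most `seq W`, for a set `W` of satellites
with `seq W ≤ a`. These bounds come from comparing the total length of disjoint intervals with the
makespan.

The schedules `twoStacks` attain these savings. If a satellite is `Large`, meaning that it can
contain the central task or be interleaved with it, a largest such satellite gives an optimal
schedule. Otherwise the problem is Subset Sum with weights `3 * α t` and capacity `a`. In the second
claim no satellite is large. If `V` is the set executed in the idle time of a competing schedule,
that schedule has length at least `seq T - seq V ≥ 2 * seq V`, so a loss of `ε * seq V` is at most
`ε / 2` times its length.

For the FPTAS, Subset Sum is solved by a table over profits, the weights being rounded down to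
multiples of `a / K`. The rounding loses at most `n * a / K`, and `K * p ≥ (n + 1) * q` makes this
at most `(p / q) * a`, hence at most `p / q` times the length of any schedule (`IsTable.best`,
`IsSolution.isApproxSchedule`). The machine only adds and subtracts, so quotients are found by
repeated subtraction and sets are stored as bit masks. Total correctness is proved with weakest
preconditions for loop-free code and counted invariants for loops. -/

namespace CoupledTask

/-! ### Lower bounds on the length of a schedule -/

/-- Pairwise disjoint intervals inside `[0, M)` have total length at most `M`. -/
theorem sum_length_le {ι : Type*} (S : Finset ι) (x l : ι → ℝ) (M : ℝ)
    (hl : ∀ i ∈ S, 0 ≤ l i) (hx : ∀ i ∈ S, 0 ≤ x i) (hM : ∀ i ∈ S, x i + l i ≤ M) (hM0 : 0 ≤ M)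
    (hd : ∀ i ∈ S, ∀ j ∈ S, i ≠ j →
      Disjoint (Set.Ico (x i) (x i + l i)) (Set.Ico (x j) (x j + l j))) :
    ∑ i ∈ S, l i ≤ M := by
  have h1 : MeasureTheory.volume (⋃ i ∈ S, Set.Ico (x i) (x i + l i)) =
      ∑ i ∈ S, MeasureTheory.volume (Set.Ico (x i) (x i + l i)) :=
    MeasureTheory.measure_biUnion_finset (fun i hi j hj hij => hd i hi j hj hij)
      fun _ _ => measurableSet_Ico
  have h2 : MeasureTheory.volume (⋃ i ∈ S, Set.Ico (x i) (x i + l i)) ≤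
      MeasureTheory.volume (Set.Ico (0 : ℝ) M) :=
    MeasureTheory.measure_mono <| Set.iUnion₂_subset fun i hi =>
      Set.Ico_subset_Ico (hx i hi) (hM i hi)
  rw [h1] at h2
  simp only [Real.volume_Ico, add_sub_cancel_left, sub_zero] at h2
  rw [← ENNReal.ofReal_sum_of_nonneg hl] at h2
  exact (ENNReal.ofReal_le_ofReal_iff hM0).1 h2

theorem Ico_disjoint_cases {x l y m : ℝ} (hl : 0 < l) (hm : 0 < m)
    (h : Disjoint (Set.Ico x (x + l)) (Set.Ico y (y + m))) : x + l ≤ y ∨ y + m ≤ x := by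
  rw [Set.Ico_disjoint_Ico] at h
  rcases le_total (x + l) (y + m) with h1 | h1 <;> rcases le_total x y with h2 | h2 <;>
    simp only [h1, h2, min_eq_left, min_eq_right, max_eq_left, max_eq_right] at h
  · exact .inl h
  · linarith
  · linarith
  · exact .inr h

theorem Ico_disjoint_of_cases {x x' y y' : ℝ} (h : x' ≤ y ∨ y' ≤ x) :
    Disjoint (Set.Ico x x') (Set.Ico y y') := by
  rw [Set.Ico_disjoint_Ico]
  rcases h with h | h
  · exact (min_le_left _ _).trans (h.trans (le_max_right _ _))
  · exact (min_le_right _ _).trans (h.trans (le_max_left _ _))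

/-- The ways in which two stretched coupled-tasks can share the processor. -/
theorem cases_of_busy_disjoint {x y a c : ℝ} (ha : 0 < a) (hc : 0 < c)
    (h : Disjoint (Set.Ico x (x + a) ∪ Set.Ico (x + 2 * a) (x + 3 * a))
      (Set.Ico y (y + c) ∪ Set.Ico (y + 2 * c) (y + 3 * c))) :
    (x + 3 * a ≤ y ∨ y + 3 * c ≤ x) ∨ (x + a ≤ y ∧ y + 3 * c ≤ x + 2 * a) ∨
      (y + c ≤ x ∧ x + 3 * a ≤ y + 2 * c) ∨ (c = a ∧ x = y + a) ∨ (c = a ∧ y = x + a) := by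
  simp only [Set.disjoint_union_left, Set.disjoint_union_right] at h
  obtain ⟨⟨h11, h12⟩, h21, h22⟩ := h
  rw [show x + 3 * a = x + 2 * a + a by ring] at h12 h22
  rw [show y + 3 * c = y + 2 * c + c by ring] at h21 h22
  have k11 := Ico_disjoint_cases ha hc h11
  have k12 := Ico_disjoint_cases ha hc h12
  have k21 := Ico_disjoint_cases ha hc h21
  have k22 := Ico_disjoint_cases ha hc h22
  rcases k11 with k11 | k11 <;> rcases k12 with k12 | k12 <;> rcases k21 with k21 | k21 <;>
    rcases k22 with k22 | k22
  -- Sixteen relative orders of the sub-tasks remain, and the impossible ones are contradictory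
  -- inequalities. An alternating order forces equality: `y + c ≤ x`, `x + a ≤ y + 2 * c` and `y + 3
  -- * c ≤ x + 2 * a` give `a ≤ c ≤ a`.
  all_goals first
    | exact .inl (.inl (by linarith))
    | exact .inl (.inr (by linarith))
    | exact .inr (.inl ⟨by linarith, by linarith⟩)
    | exact .inr (.inr (.inl ⟨by linarith, by linarith⟩))
    | exact .inr (.inr (.inr (.inl ⟨by linarith, by linarith⟩)))
    | exact .inr (.inr (.inr (.inr ⟨by linarith, by linarith⟩)))

theorem le_makespan {T : Type*} [Finite T] (α : T → ℕ) (σ : T → ℝ) (t : T) :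
    σ t + 3 * α t ≤ makespan α σ :=
  le_ciSup (f := fun t => σ t + 3 * (α t : ℝ)) (Set.finite_range _).bddAbove t

theorem makespan_le {T : Type*} [Nonempty T] (α : T → ℕ) (σ : T → ℝ) (M : ℝ)
    (h : ∀ t, σ t + 3 * α t ≤ M) : makespan α σ ≤ M :=
  ciSup_le h

variable {n : ℕ} {α : Fin (n + 1) → ℕ} {τ : Fin (n + 1) → ℝ}

theorem Feasible.satellite_cases (pos : ∀ t, 0 < α t) (h : Feasible (SimpleGraph.starGraph 0) α τ)
    {t : Fin (n + 1)} (ht : t ≠ 0) :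
    (τ 0 + 3 * α 0 ≤ τ t ∨ τ t + 3 * α t ≤ τ 0) ∨
      (τ 0 + α 0 ≤ τ t ∧ τ t + 3 * α t ≤ τ 0 + 2 * α 0) ∨
      (τ t + α t ≤ τ 0 ∧ τ 0 + 3 * α 0 ≤ τ t + 2 * α t) ∨
      ((α t : ℝ) = α 0 ∧ τ 0 = τ t + α 0) ∨ ((α t : ℝ) = α 0 ∧ τ t = τ 0 + α 0) :=
  cases_of_busy_disjoint (by exact_mod_cast pos 0) (by exact_mod_cast pos t) (h.2.1 0 t ht.symm)

theorem Feasible.satellites_disjoint (h : Feasible (SimpleGraph.starGraph 0) α τ)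
    {t u : Fin (n + 1)} (ht : t ≠ 0) (hu : u ≠ 0) (htu : t ≠ u) :
    Disjoint (span α τ t) (span α τ u) :=
  h.2.2 t u htu (by simp [ht, hu])

theorem seq_cast (S : Finset (Fin (n + 1))) : (seq α S : ℝ) = ∑ t ∈ S, 3 * (α t : ℝ) := by
  simp [seq]

theorem seq_univ (α : Fin (n + 1) → ℕ) :
    seq α Finset.univ = 3 * α 0 + seq α (Finset.univ.erase 0) :=
  (Finset.add_sum_erase _ (fun t => 3 * α t) (Finset.mem_univ 0)).symm

theorem makespan_nonneg (h : Feasible (SimpleGraph.starGraph 0) α τ) : 0 ≤ makespan α τ :=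
  (add_nonneg (h.1 0) (by positivity)).trans (le_makespan α τ 0)

/-- The satellites are executed one after the other. -/
theorem Feasible.seq_satellites_le (h : Feasible (SimpleGraph.starGraph 0) α τ) :
    (seq α (Finset.univ.erase 0) : ℝ) ≤ makespan α τ := by
  rw [seq_cast]
  refine sum_length_le _ τ _ _ (fun _ _ => by positivity) (fun t _ => h.1 t)
    (fun t _ => le_makespan α τ t) (makespan_nonneg h) fun t ht u hu htu => ?_
  exact h.satellites_disjoint (Finset.ne_of_mem_erase ht) (Finset.ne_of_mem_erase hu) htu

/-- If an interval of length `α 0` inside the span of the central task is disjoint from all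
satellites, then at most two thirds of the span of the central task are shared. -/
theorem Feasible.seq_le_of_extra (h : Feasible (SimpleGraph.starGraph 0) α τ) (y : ℝ)
    (h1 : τ 0 ≤ y) (h2 : y + α 0 ≤ τ 0 + 3 * α 0)
    (hd : ∀ t, t ≠ 0 → Disjoint (Set.Ico y (y + α 0)) (span α τ t)) :
    (seq α Finset.univ : ℝ) ≤ makespan α τ + 2 * α 0 := by
  -- The central task is represented by the free interval of length `α 0` instead of its whole span.
  -- All intervals are then disjoint, and only `2 * α 0` of the sequential length is not counted.
  have key : ∑ t, Function.update (fun t => 3 * (α t : ℝ)) 0 (α 0) t ≤ makespan α τ := by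
    refine sum_length_le _ (Function.update τ 0 y) _ _ (fun t _ => ?_) (fun t _ => ?_)
      (fun t _ => ?_) (makespan_nonneg h) fun t _ u _ htu => ?_
    · by_cases ht : t = 0
      · subst ht; simp
      · simp [ht]
    · by_cases ht : t = 0
      · subst ht; simpa using (h.1 0).trans h1
      · simpa [ht] using h.1 t
    · by_cases ht : t = 0
      · subst ht; simpa using h2.trans (le_makespan α τ 0)
      · simpa [ht] using le_makespan α τ t
    · by_cases ht : t = 0
      · subst ht
        simp only [Function.update_self, Function.update_of_ne htu.symm]
        exact hd u htu.symm
      · by_cases hu : u = 0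
        · subst hu
          simp only [Function.update_self, Function.update_of_ne htu]
          exact (hd t htu).symm
        · simp only [Function.update_of_ne ht, Function.update_of_ne hu]
          exact h.satellites_disjoint ht hu htu
  rw [Finset.sum_update_of_mem (Finset.mem_univ _), ← Finset.erase_eq, ← seq_cast] at key
  have := seq_univ α
  have h3 : (seq α Finset.univ : ℝ) = 3 * α 0 + seq α (Finset.univ.erase 0) := by exact_mod_cast this
  linarith

/-- Satellites executed within the idle time of the central task form a feasible set of items. -/
theorem Feasible.seq_le_of_idle (h : Feasible (SimpleGraph.starGraph 0) α τ)
    (W : Finset (Fin (n + 1)))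
    (hW : ∀ t ∈ W, t ≠ 0 ∧ τ 0 + α 0 ≤ τ t ∧ τ t + 3 * α t ≤ τ 0 + 2 * α 0) :
    seq α W ≤ α 0 := by
  have : (seq α W : ℝ) ≤ α 0 := by
    rw [seq_cast]
    refine sum_length_le _ (fun t => τ t - τ 0 - α 0) _ _ (fun _ _ => by positivity)
      (fun t ht => by linarith [(hW t ht).2.1]) (fun t ht => by linarith [(hW t ht).2.2])
      (by positivity) fun t ht u hu htu => ?_
    have := h.satellites_disjoint (hW t ht).1 (hW u hu).1 htu
    rw [span, span, Set.Ico_disjoint_Ico] at this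
    rw [Set.Ico_disjoint_Ico]
    have e : ∀ v, τ v - τ 0 - α 0 + 3 * (α v : ℝ) = τ v + 3 * α v - (τ 0 + α 0) := fun v => by ring
    have e' : ∀ v, τ v - τ 0 - α 0 = τ v - (τ 0 + α 0) := fun v => by ring
    rw [e, e, e', e', min_sub_sub_right, max_sub_sub_right]
    linarith
  exact_mod_cast this

/-- Once the satellites in the idle time are removed, all remaining tasks, the central one included,
have pairwise disjoint spans. Only the removed set can therefore save time. -/
theorem Feasible.seq_le_of_dichotomy (h : Feasible (SimpleGraph.starGraph 0) α τ)
    (hd : ∀ t, t ≠ 0 → (τ 0 + 3 * α 0 ≤ τ t ∨ τ t + 3 * α t ≤ τ 0) ∨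
      (τ 0 + α 0 ≤ τ t ∧ τ t + 3 * α t ≤ τ 0 + 2 * α 0)) :
    ∃ W : Finset (Fin (n + 1)), 0 ∉ W ∧ seq α W ≤ α 0 ∧
      (seq α Finset.univ : ℝ) ≤ makespan α τ + seq α W := by
  classical
  set W : Finset (Fin (n + 1)) := Finset.univ.filter fun t =>
    t ≠ 0 ∧ τ 0 + α 0 ≤ τ t ∧ τ t + 3 * α t ≤ τ 0 + 2 * α 0 with hW
  refine ⟨W, by simp [hW], h.seq_le_of_idle W (by simp [hW]), ?_⟩
  have key : ∑ t ∈ Wᶜ, 3 * (α t : ℝ) ≤ makespan α τ := by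
    refine sum_length_le _ τ _ _ (fun _ _ => by positivity) (fun t _ => h.1 t)
      (fun t _ => le_makespan α τ t) (makespan_nonneg h) fun t ht u hu htu => ?_
    have aux : ∀ v ∈ Wᶜ, v ≠ 0 → τ 0 + 3 * α 0 ≤ τ v ∨ τ v + 3 * α v ≤ τ 0 := by
      intro v hv hv0
      rcases hd v hv0 with h1 | h1
      · exact h1
      · simp [hW, hv0] at hv
        exact absurd h1.2 (not_le.2 (hv h1.1))
    by_cases ht0 : t = 0
    · subst ht0; exact Ico_disjoint_of_cases (aux u hu htu.symm)
    · by_cases hu0 : u = 0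
      · subst hu0; exact Ico_disjoint_of_cases (aux t ht ht0).symm
      · exact h.satellites_disjoint ht0 hu0 htu
  rw [← seq_cast] at key
  have : seq α Finset.univ = seq α W + seq α Wᶜ := (Finset.sum_add_sum_compl W _).symm
  rw [this]
  push_cast
  linarith

/-- The three ways to bound the length of a feasible schedule from below. -/
theorem Feasible.lower_bound (pos : ∀ t, 0 < α t) (h : Feasible (SimpleGraph.starGraph 0) α τ) :
    ((∃ t, t ≠ 0 ∧ 3 * α 0 ≤ α t) ∧ (seq α Finset.univ : ℝ) ≤ makespan α τ + 3 * α 0) ∨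
    ((∃ t, t ≠ 0 ∧ α t = α 0) ∧ (seq α Finset.univ : ℝ) ≤ makespan α τ + 2 * α 0) ∨
    ∃ W : Finset (Fin (n + 1)), 0 ∉ W ∧ seq α W ≤ α 0 ∧
      (seq α Finset.univ : ℝ) ≤ makespan α τ + seq α W := by
  have a0 : (0 : ℝ) < α 0 := by exact_mod_cast pos 0
  by_cases hbig : ∃ t, t ≠ 0 ∧ 3 * α 0 ≤ α t
  · refine .inl ⟨hbig, ?_⟩
    have h3 : (seq α Finset.univ : ℝ) = 3 * α 0 + seq α (Finset.univ.erase 0) := by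
      exact_mod_cast seq_univ α
    linarith [h.seq_satellites_le]
  have hnb : ∀ t, t ≠ 0 → (α t : ℝ) < 3 * α 0 := by
    intro t ht
    by_contra hc
    exact hbig ⟨t, ht, by exact_mod_cast not_lt.1 hc⟩
  right
  -- No satellite can contain the central task any more, so an interleaved satellite is the only
  -- obstacle to the dichotomy between sequential and idle-time execution.
  by_cases heq : ∃ t, t ≠ 0 ∧ (α t : ℝ) = α 0 ∧ (τ 0 = τ t + α 0 ∨ τ t = τ 0 + α 0)
  · obtain ⟨s, hs0, hs, hsτ⟩ := heq
    refine .inl ⟨⟨s, hs0, by exact_mod_cast hs⟩, ?_⟩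
    have ps : (0 : ℝ) < α s := by exact_mod_cast pos s
    rcases hsτ with hsτ | hsτ
    -- Here `s` starts first and ends when the second sub-task of the central task begins. That
    -- sub-task meets no satellite: one interleaved on the other side would overlap `s`. The mirror
    -- case below uses the first sub-task.
    · refine h.seq_le_of_extra (τ 0 + 2 * α 0) (by linarith) (by linarith) fun t ht => ?_
      have pt : (0 : ℝ) < α t := by exact_mod_cast pos t
      apply Ico_disjoint_of_cases
      by_cases hts : t = s
      · subst hts; right; linarith
      have hd := h.satellites_disjoint ht hs0 hts
      have hd' := Ico_disjoint_cases (by positivity) (by positivity) hd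
      have := hnb t ht
      rcases h.satellite_cases pos ht with (h1 | h1) | h1 | h1 | h1 | h1
      · left; linarith
      · right; linarith
      · right; linarith
      · linarith
      · right; linarith
      · exfalso; rcases hd' with h2 | h2 <;> linarith
    · refine h.seq_le_of_extra (τ 0) (by linarith) (by linarith) fun t ht => ?_
      have pt : (0 : ℝ) < α t := by exact_mod_cast pos t
      apply Ico_disjoint_of_cases
      by_cases hts : t = s
      · subst hts; left; linarith
      have hd := h.satellites_disjoint ht hs0 hts
      have hd' := Ico_disjoint_cases (by positivity) (by positivity) hd
      have := hnb t ht
      rcases h.satellite_cases pos ht with (h1 | h1) | h1 | h1 | h1 | h1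
      · left; linarith
      · right; linarith
      · left; linarith
      · linarith
      · exfalso; rcases hd' with h2 | h2 <;> linarith
      · left; linarith
  · refine .inr (h.seq_le_of_dichotomy fun t ht => ?_)
    have := hnb t ht
    rcases h.satellite_cases pos ht with h1 | h1 | h1 | h1 | h1
    · exact .inl h1
    · exact .inr h1
    · linarith
    · exact absurd ⟨t, ht, h1.1, .inl h1.2⟩ heq
    · exact absurd ⟨t, ht, h1.1, .inr h1.2⟩ heq

/-! ### A family of schedules -/

/-- The time needed for the tasks of `S` whose index is larger than `t`. -/
def after (α : Fin (n + 1) → ℕ) (S : Finset (Fin (n + 1))) (t : Fin (n + 1)) : ℕ :=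
  seq α (S.filter (t < ·))

/-- The satellites that are neither in `W` nor equal to `s`. -/
def rest (W : Finset (Fin (n + 1))) (s : Fin (n + 1)) : Finset (Fin (n + 1)) :=
  Finset.univ.filter fun t => t ≠ 0 ∧ t ∉ W ∧ t ≠ s

/-- The central task starts at `x`, the tasks of `W` are executed one after the other from time
`α 0` on, the task `s` (if it is a satellite) starts at `0`, and the other tasks are executed one
after the other from time `B` on. -/
def twoStacks (α : Fin (n + 1) → ℕ) (W : Finset (Fin (n + 1))) (s : Fin (n + 1)) (x B : ℕ)
    (t : Fin (n + 1)) : ℕ :=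
  if t = 0 then x else if t ∈ W then α 0 + after α W t else if t = s then 0
  else B + after α (rest W s) t

theorem after_add_le (S : Finset (Fin (n + 1))) {t u : Fin (n + 1)} (hu : u ∈ S) (h : t < u) :
    after α S u + 3 * α u ≤ after α S t := by
  have hsub : insert u (S.filter (u < ·)) ⊆ S.filter (t < ·) := by
    intro v hv
    simp only [Finset.mem_insert, Finset.mem_filter] at hv ⊢
    rcases hv with rfl | hv
    · exact ⟨hu, h⟩
    · exact ⟨hv.1, h.trans hv.2⟩
  have h1 : seq α (insert u (S.filter (u < ·))) ≤ after α S t :=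
    Finset.sum_le_sum_of_subset hsub
  rw [seq, Finset.sum_insert (by simp)] at h1
  simp only [after, seq] at h1 ⊢
  omega

theorem after_add_le_seq (S : Finset (Fin (n + 1))) {u : Fin (n + 1)} (hu : u ∈ S) :
    after α S u + 3 * α u ≤ seq α S := by
  have h1 : seq α (insert u (S.filter (u < ·))) ≤ seq α S :=
    Finset.sum_le_sum_of_subset (Finset.insert_subset hu (Finset.filter_subset _ _))
  rw [seq, Finset.sum_insert (by simp)] at h1
  simp only [after, seq] at h1 ⊢
  omega

theorem seq_univ_eq_rest {W : Finset (Fin (n + 1))} (hW : 0 ∉ W) :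
    seq α Finset.univ = 3 * α 0 + seq α W + seq α (rest W 0) := by
  have e : rest W 0 = (Finset.univ.erase 0) \ W := by
    ext t; simp [rest]; tauto
  have hsub : W ⊆ Finset.univ.erase 0 := fun t ht =>
    Finset.mem_erase.2 ⟨fun h => hW (h ▸ ht), Finset.mem_univ _⟩
  have := Finset.sum_sdiff (f := fun t => 3 * α t) hsub
  have h2 := seq_univ α
  rw [e]
  simp only [seq] at *
  omega

theorem seq_univ_eq_rest_empty {s : Fin (n + 1)} (hs : s ≠ 0) :
    seq α Finset.univ = 3 * α 0 + 3 * α s + seq α (rest ∅ s) := by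
  have e : rest ∅ s = (Finset.univ.erase 0).erase s := by
    ext t; simp [rest, and_comm]
  have := Finset.add_sum_erase (Finset.univ.erase 0) (fun t => 3 * α t)
    (Finset.mem_erase.2 ⟨hs, Finset.mem_univ s⟩)
  have h2 := seq_univ α
  rw [e]
  simp only [seq] at *
  omega

/-- The machine writes natural start times. The alternatives for the central task are only those
that occur in `twoStacks`: a satellite after it, inside its idle time, around it, or interleaved and
starting first. -/
theorem feasible_of_nat (σ : Fin (n + 1) → ℕ)
    (hsat : ∀ t u, t ≠ 0 → u ≠ 0 → t < u → σ t + 3 * α t ≤ σ u ∨ σ u + 3 * α u ≤ σ t)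
    (hc : ∀ t, t ≠ 0 → (σ 0 + 3 * α 0 ≤ σ t) ∨ (σ 0 + α 0 ≤ σ t ∧ σ t + 3 * α t ≤ σ 0 + 2 * α 0) ∨
      (σ t + α t ≤ σ 0 ∧ σ 0 + 3 * α 0 ≤ σ t + 2 * α t) ∨ (α t = α 0 ∧ σ 0 = σ t + α t)) :
    Feasible (SimpleGraph.starGraph 0) α (fun t => (σ t : ℝ)) := by
  set τ : Fin (n + 1) → ℝ := fun t => (σ t : ℝ) with hτ
  have dsat : ∀ t u, t ≠ 0 → u ≠ 0 → t ≠ u → Disjoint (span α τ t) (span α τ u) := by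
    intro t u ht hu htu
    rcases lt_or_gt_of_ne htu with h | h
    · exact Ico_disjoint_of_cases (by simp only [hτ]; exact_mod_cast hsat t u ht hu h)
    · exact Ico_disjoint_of_cases (by simp only [hτ]; exact_mod_cast (hsat u t hu ht h).symm)
  have bsub : ∀ t, busy α τ t ⊆ span α τ t := by
    intro t
    have : (0 : ℝ) ≤ α t := by positivity
    exact Set.union_subset (Set.Ico_subset_Ico le_rfl (by linarith))
      (Set.Ico_subset_Ico (by linarith) le_rfl)
  have dcen : ∀ t, t ≠ 0 → Disjoint (busy α τ 0) (busy α τ t) := by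
    intro t ht
    have p0 : (0 : ℝ) ≤ α 0 := by positivity
    have pt : (0 : ℝ) ≤ α t := by positivity
    have hc' : (τ 0 + 3 * α 0 ≤ τ t) ∨ (τ 0 + α 0 ≤ τ t ∧ τ t + 3 * α t ≤ τ 0 + 2 * α 0) ∨
      (τ t + α t ≤ τ 0 ∧ τ 0 + 3 * α 0 ≤ τ t + 2 * α t) ∨ ((α t : ℝ) = α 0 ∧ τ 0 = τ t + α t) := by
      simp only [hτ]
      exact_mod_cast hc t ht
    simp only [busy, Set.disjoint_union_left, Set.disjoint_union_right]
    refine ⟨⟨Ico_disjoint_of_cases ?_, Ico_disjoint_of_cases ?_⟩,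
      Ico_disjoint_of_cases ?_, Ico_disjoint_of_cases ?_⟩ <;>
    · rcases hc' with h | h | h | h <;>
      first
      | (left; linarith)
      | (right; linarith)
  refine ⟨fun t => by positivity, fun t u htu => ?_, fun t u htu hadj => ?_⟩
  · by_cases ht : t = 0
    · subst ht; exact dcen u htu.symm
    · by_cases hu : u = 0
      · subst hu; exact (dcen t htu).symm
      · exact (dsat t u ht hu htu).mono (bsub t) (bsub u)
  · simp only [SimpleGraph.starGraph_adj, not_and, not_or] at hadj
    exact dsat t u (hadj htu).1 (hadj htu).2 htu

/-- The schedule with the tasks of `W` in the idle time of the central task is feasible. -/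
theorem twoStacks_feasible {W : Finset (Fin (n + 1))} (hW : seq α W ≤ α 0) :
    Feasible (SimpleGraph.starGraph 0) α (fun t => (twoStacks α W 0 0 (3 * α 0) t : ℝ)) := by
  apply feasible_of_nat
  · intro t u ht hu htu
    simp only [twoStacks, ht, hu, if_false]
    by_cases htW : t ∈ W <;> by_cases huW : u ∈ W <;> simp only [htW, huW, if_true, if_false]
    · have := after_add_le (α := α) W huW htu
      right; omega
    · have := after_add_le_seq (α := α) W htW
      left; omega
    · have := after_add_le_seq (α := α) W huW
      right; omega
    · have := after_add_le (α := α) (rest W 0) (u := u) (by simp [rest, hu, huW]) htu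
      right; omega
  · intro t ht
    simp only [twoStacks, ht, if_false, if_true]
    by_cases htW : t ∈ W <;> simp only [htW, if_true, if_false]
    · have := after_add_le_seq (α := α) W htW
      right; left; omega
    · left; omega

theorem twoStacks_makespan_le {W : Finset (Fin (n + 1))} (hW0 : 0 ∉ W) (hW : seq α W ≤ α 0) :
    makespan α (fun t => (twoStacks α W 0 0 (3 * α 0) t : ℝ)) ≤
      (seq α Finset.univ : ℝ) - seq α W := by
  have e := seq_univ_eq_rest (α := α) hW0
  apply makespan_le
  intro t
  rw [e]
  push_cast
  suffices h : twoStacks α W 0 0 (3 * α 0) t + 3 * α t ≤ 3 * α 0 + seq α (rest W 0) by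
    have h' : (twoStacks α W 0 0 (3 * α 0) t : ℝ) + 3 * α t ≤ 3 * α 0 + seq α (rest W 0) := by
      exact_mod_cast h
    linarith
  by_cases ht : t = 0
  · subst ht; simp [twoStacks]
  simp only [twoStacks, ht, if_false]
  by_cases htW : t ∈ W <;> simp only [htW, if_true, if_false]
  · have := after_add_le_seq (α := α) W htW
    omega
  · have := after_add_le_seq (α := α) (rest W 0) (u := t) (by simp [rest, ht, htW])
    omega

theorem twoStacks_makespan {W : Finset (Fin (n + 1))} (hW0 : 0 ∉ W) (hW : seq α W ≤ α 0) :
    makespan α (fun t => (twoStacks α W 0 0 (3 * α 0) t : ℝ)) =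
      (seq α Finset.univ : ℝ) - seq α W := by
  refine le_antisymm (twoStacks_makespan_le hW0 hW) ?_
  have e := seq_univ_eq_rest (α := α) hW0
  rw [e]
  push_cast
  suffices h : ∃ t, 3 * α 0 + seq α (rest W 0) ≤ twoStacks α W 0 0 (3 * α 0) t + 3 * α t by
    obtain ⟨t, h⟩ := h
    have h' : (3 * α 0 + seq α (rest W 0) : ℝ) ≤ twoStacks α W 0 0 (3 * α 0) t + 3 * α t := by
      exact_mod_cast h
    linarith [le_makespan α (fun t => (twoStacks α W 0 0 (3 * α 0) t : ℝ)) t]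
  rcases (rest W 0).eq_empty_or_nonempty with h | h
  · exact ⟨0, by simp [h, seq, twoStacks]⟩
  -- Each stack is filled in decreasing order of index, so the satellite of smallest index outside
  -- `W` finishes last.
  · have hm := Finset.min'_mem _ h
    set m := (rest W 0).min' h with hmdef
    refine ⟨m, ?_⟩
    have hm' := hm
    simp only [rest, Finset.mem_filter, Finset.mem_univ, true_and] at hm'
    have e2 : rest W 0 = insert m ((rest W 0).filter (m < ·)) := by
      ext u
      simp only [Finset.mem_insert, Finset.mem_filter]
      constructor
      · intro hu
        rcases (Finset.min'_le _ u hu).lt_or_eq with h1 | h1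
        · exact .inr ⟨hu, h1⟩
        · exact .inl h1.symm
      · rintro (rfl | hu)
        · exact hm
        · exact hu.1
    have e3 : seq α (rest W 0) = 3 * α m + after α (rest W 0) m := by
      conv_lhs => rw [e2]
      rw [seq, Finset.sum_insert (by simp)]
      rfl
    simp only [twoStacks, hm'.1, hm'.2.1, if_false]
    omega

/-- The tasks of `W` are exactly those executed within the idle time of the central task. -/
theorem twoStacks_mem_iff (pos : ∀ t, 0 < α t) {W : Finset (Fin (n + 1))} (hW0 : 0 ∉ W)
    (hW : seq α W ≤ α 0) (t : Fin (n + 1)) :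
    t ∈ W ↔ span α (fun t => (twoStacks α W 0 0 (3 * α 0) t : ℝ)) t ⊆
      idle α (fun t => (twoStacks α W 0 0 (3 * α 0) t : ℝ)) 0 := by
  have p0 : (0 : ℝ) < α 0 := by exact_mod_cast pos 0
  have pt : (0 : ℝ) < α t := by exact_mod_cast pos t
  have hz : twoStacks α W 0 0 (3 * α 0) 0 = 0 := by simp [twoStacks]
  rw [span, idle, Set.Ico_subset_Ico_iff (by linarith), hz]
  constructor
  · intro htW
    have ht : t ≠ 0 := fun h => hW0 (h ▸ htW)
    have := after_add_le_seq (α := α) W htW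
    simp only [twoStacks, ht, htW, if_false, if_true]
    constructor
    · push_cast; linarith [(Nat.cast_nonneg (after α W t) : (0 : ℝ) ≤ _)]
    · have h2 : (α 0 + after α W t + 3 * α t : ℕ) ≤ 0 + 2 * α 0 := by omega
      exact_mod_cast h2
  · rintro ⟨h1, h2⟩
    by_contra htW
    have h2' : twoStacks α W 0 0 (3 * α 0) t + 3 * α t ≤ 0 + 2 * α 0 := by exact_mod_cast h2
    have := pos t
    have := pos 0
    by_cases ht : t = 0
    · subst ht
      rw [hz] at h2'
      omega
    · simp only [twoStacks, ht, htW, if_false] at h2'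
      omega

/-- The schedule in which the central task starts after the first sub-task of `s`. -/
theorem twoStacks_special {s : Fin (n + 1)} (hs : s ≠ 0) (h : α s = α 0 ∨ 3 * α 0 ≤ α s) (B : ℕ)
    (hB : 3 * α s ≤ B) (hB' : α s + 3 * α 0 ≤ B) :
    Feasible (SimpleGraph.starGraph 0) α (fun t => (twoStacks α ∅ s (α s) B t : ℝ)) ∧
    makespan α (fun t => (twoStacks α ∅ s (α s) B t : ℝ)) ≤
      (seq α Finset.univ : ℝ) + B - 3 * α 0 - 3 * α s := by
  constructor
  · apply feasible_of_nat
    · intro t u ht hu htu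
      simp only [twoStacks, ht, hu, if_false, Finset.notMem_empty]
      by_cases hts : t = s <;> by_cases hus : u = s
      · exact absurd (hts.trans hus.symm) htu.ne
      · simp only [hts, hus, if_true, if_false]; left; omega
      · simp only [hts, hus, if_true, if_false]; right; omega
      · have := after_add_le (α := α) (rest ∅ s) (u := u) (by simp [rest, hu, hus]) htu
        simp only [hts, hus, if_false]; right; omega
    · intro t ht
      simp only [twoStacks, ht, if_false, if_true, Finset.notMem_empty]
      by_cases hts : t = s
      · subst hts
        simp only [if_true]
        omega
      · simp only [hts, if_false]; left; omega
  · have e := seq_univ_eq_rest_empty (α := α) hs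
    apply makespan_le
    intro t
    rw [e]
    push_cast
    suffices h : twoStacks α ∅ s (α s) B t + 3 * α t ≤ B + seq α (rest ∅ s) by
      have h' : (twoStacks α ∅ s (α s) B t : ℝ) + 3 * α t ≤ B + seq α (rest ∅ s) := by
        exact_mod_cast h
      linarith
    by_cases ht : t = 0
    · subst ht; simp [twoStacks]; omega
    simp only [twoStacks, ht, if_false, Finset.notMem_empty]
    by_cases hts : t = s
    · subst hts; simp; omega
    · have := after_add_le_seq (α := α) (rest ∅ s) (u := t) (by simp [rest, ht, hts])
      simp only [hts, if_false]
      omega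

/-! ### Approximation through Subset Sum -/

theorem three_mul_seq_le {W : Finset (Fin (n + 1))} (hW0 : 0 ∉ W) (hW : seq α W ≤ α 0) :
    3 * seq α W ≤ seq α Finset.univ := by
  have := seq_univ_eq_rest (α := α) hW0
  omega

theorem subsetSum_feasible_iff {W : Finset (Fin (n + 1))} :
    SubsetSum.Feasible (Finset.univ.erase 0) (fun t => 3 * α t) (α 0) W ↔
      0 ∉ W ∧ seq α W ≤ α 0 := by
  simp only [SubsetSum.Feasible, seq, and_congr_left_iff]
  refine fun _ => ⟨fun h h0 => by simpa using h h0, fun h t ht => ?_⟩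
  exact Finset.mem_erase.2 ⟨fun h' => h (h' ▸ ht), Finset.mem_univ _⟩

theorem twoStacks_isApprox (pos : ∀ t, 0 < α t) (hinc : ∀ t, t ≠ 0 → α t < α 0) {ε : ℝ}
    (hε : 0 ≤ ε) {W : Finset (Fin (n + 1))}
    (hW : SubsetSum.IsApprox (Finset.univ.erase 0) (fun t => 3 * α t) (α 0) (1 - ε) W) :
    IsApproxSchedule (SimpleGraph.starGraph 0) α (1 + ε / 2)
      (fun t => (twoStacks α W 0 0 (3 * α 0) t : ℝ)) := by
  obtain ⟨hf, happ⟩ := hW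
  rw [subsetSum_feasible_iff] at hf
  refine ⟨twoStacks_feasible hf.2, fun τ hτ => ?_⟩
  refine (twoStacks_makespan_le hf.1 hf.2).trans ?_
  rcases hτ.lower_bound pos with ⟨⟨t, ht, h⟩, -⟩ | ⟨⟨t, ht, h⟩, -⟩ | ⟨V, hV0, hV, hle⟩
  · have := hinc t ht; omega
  · have := hinc t ht; omega
  · have h1 : (1 - ε) * (seq α V : ℝ) ≤ seq α W := happ V (subsetSum_feasible_iff.2 ⟨hV0, hV⟩)
    have h2 : 3 * (seq α V : ℝ) ≤ seq α Finset.univ := by exact_mod_cast three_mul_seq_le hV0 hV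
    -- Since `seq V` is at most a third of the sequential length, the competing schedule is at least
    -- `2 * seq V` long. This is where the factor `1 / 2` of `ε` comes from.
    have h3 : ε * (2 * (seq α V : ℝ)) ≤ ε * makespan α τ :=
      mul_le_mul_of_nonneg_left (by linarith) hε
    linarith

end CoupledTask

/-! ### A table for Subset Sum with rounded profits -/

namespace RoundedSubsetSum

/-- The profit of an item: its weight in units of `a / K`, rounded down. -/
def profit (w : ℕ → ℕ) (a K t : ℕ) : ℕ := K * w t / a

/-- The table `R`, `M` after the items `1, …, i`.  If `R l` is positive then `M l` is the bit mask
of a set of profit `l` whose weight is `a + 1 - R l`, and no set of profit `l` has a smaller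
weight.  If `R l` is zero then no set of profit `l` has weight at most `a`. -/
structure IsTable (w : ℕ → ℕ) (a K i : ℕ) (R M : ℕ → ℕ) : Prop where
  lower : ∀ S ⊆ Finset.Icc 1 i, ∑ t ∈ S, w t ≤ a →
    a + 1 ≤ R (∑ t ∈ S, profit w a K t) + ∑ t ∈ S, w t
  upper : ∀ l, 0 < R l → ∃ S ⊆ Finset.Icc 1 i, M l = ∑ t ∈ S, 2 ^ t ∧
    ∑ t ∈ S, w t + R l = a + 1 ∧ ∑ t ∈ S, profit w a K t = l

/-- The condition under which entry `l` changes when an item of weight `w` and profit `p` is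
considered. -/
def Improves (K p w : ℕ) (R : ℕ → ℕ) (l : ℕ) : Prop := p ≤ l ∧ l ≤ K ∧ R l < R (l - p) - w

instance (K p w : ℕ) (R : ℕ → ℕ) (l : ℕ) : Decidable (Improves K p w R l) := by
  unfold Improves; infer_instance

/-- The weight table after one more item. -/
def nextR (K p w : ℕ) (R : ℕ → ℕ) (l : ℕ) : ℕ :=
  if Improves K p w R l then R (l - p) - w else R l

/-- The mask table after one more item. -/
def nextM (K p w b : ℕ) (R M : ℕ → ℕ) (l : ℕ) : ℕ :=
  if Improves K p w R l then M (l - p) + b else M l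

variable {w : ℕ → ℕ} {a K i : ℕ} {R M : ℕ → ℕ}

/-- Storing `a + 1` minus the weight makes zero mean "absent", so untouched memory is already
correct and only entry `0` must be written. Truncated subtraction then discards overweight sets by
itself. -/
theorem isTable_zero {R M : ℕ → ℕ} (hR0 : R 0 = a + 1) (hR : ∀ l, l ≠ 0 → R l = 0)
    (hM : M 0 = 0) : IsTable w a K 0 R M where
  lower S hS _ := by
    obtain rfl : S = ∅ := by simpa using hS
    simp [hR0]
  upper l hl := by
    obtain rfl : l = 0 := by
      by_contra h
      rw [hR l h] at hl
      exact lt_irrefl _ hl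
    exact ⟨∅, by simp, by simp [hM], by simp [hR0], by simp⟩

theorem sum_profit_mul_le (S : Finset ℕ) :
    a * ∑ t ∈ S, profit w a K t ≤ K * ∑ t ∈ S, w t := by
  rw [Finset.mul_sum, Finset.mul_sum]
  exact Finset.sum_le_sum fun t _ => Nat.mul_div_le _ _

/-- Rounding down costs each item less than one unit, that is less than `a` after multiplication by
`a`. -/
theorem le_sum_profit_mul (ha : 0 < a) (S : Finset ℕ) :
    K * ∑ t ∈ S, w t ≤ a * ∑ t ∈ S, profit w a K t + S.card * a := by
  rw [Finset.mul_sum, Finset.mul_sum, ← smul_eq_mul S.card a, ← Finset.sum_const,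
    ← Finset.sum_add_distrib]
  refine Finset.sum_le_sum fun t _ => ?_
  have := Nat.lt_mul_div_succ (K * w t) ha
  simp only [profit]
  linarith

theorem IsTable.le (h : IsTable w a K i R M) (l : ℕ) : R l ≤ a + 1 := by
  rcases Nat.eq_zero_or_pos (R l) with h0 | h0
  · omega
  · obtain ⟨S, -, -, h1, -⟩ := h.upper l h0
    omega

theorem IsTable.next (h : IsTable w a K i R M) (ha : 0 < a) {p : ℕ}
    (hp : w (i + 1) ≤ a → p = profit w a K (i + 1)) :
    IsTable w a K (i + 1) (nextR K p (w (i + 1)) R) (nextM K p (w (i + 1)) (2 ^ (i + 1)) R M) where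
  lower S hS hw := by
    have mono : ∀ l, R l ≤ nextR K p (w (i + 1)) R l := by
      intro l
      unfold nextR
      split_ifs with hi
      · exact hi.2.2.le
      · exact le_rfl
    by_cases hmem : i + 1 ∈ S
    · obtain ⟨S', hS', rfl⟩ : ∃ S', i + 1 ∉ S' ∧ insert (i + 1) S' = S :=
        ⟨S.erase (i + 1), by simp, Finset.insert_erase hmem⟩
      have hsub : S' ⊆ Finset.Icc 1 i := by
        intro t ht
        have h1 := Finset.mem_Icc.1 (hS (Finset.mem_insert_of_mem ht))
        have h2 : t ≠ i + 1 := fun h => hS' (h ▸ ht)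
        exact Finset.mem_Icc.2 ⟨h1.1, by omega⟩
      -- A set within the capacity has profit at most `K`, so the table need not extend further.
      have hprof : ∑ t ∈ insert (i + 1) S', profit w a K t ≤ K := by
        have h1 := sum_profit_mul_le (w := w) (a := a) (K := K) (insert (i + 1) S')
        have h2 : K * ∑ t ∈ insert (i + 1) S', w t ≤ K * a := Nat.mul_le_mul_left _ hw
        rw [mul_comm K a] at h2
        exact Nat.le_of_mul_le_mul_left (h1.trans h2) ha
      rw [Finset.sum_insert hS'] at hw hprof ⊢
      rw [Finset.sum_insert hS']
      obtain rfl := hp (by omega)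
      have hl := h.lower S' hsub (by omega)
      have e := Nat.add_sub_cancel_left (profit w a K (i + 1)) (∑ t ∈ S', profit w a K t)
      unfold nextR
      split_ifs with hi
      · rw [e]
        omega
      · have : ¬ R (profit w a K (i + 1) + ∑ t ∈ S', profit w a K t) <
            R (∑ t ∈ S', profit w a K t) - w (i + 1) :=
          fun h => hi ⟨by omega, hprof, by rwa [e]⟩
        omega
    · have hsub : S ⊆ Finset.Icc 1 i := by
        intro t ht
        have h1 := Finset.mem_Icc.1 (hS ht)
        have h2 : t ≠ i + 1 := fun h => hmem (h ▸ ht)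
        exact Finset.mem_Icc.2 ⟨h1.1, by omega⟩
      have := h.lower S hsub hw
      have := mono (∑ t ∈ S, profit w a K t)
      omega
  upper l hl := by
    unfold nextR at hl ⊢
    unfold nextM
    split_ifs at hl ⊢ with hi
    · have hle := h.le (l - p)
      obtain ⟨S, hS, h1, h2, h3⟩ := h.upper (l - p) (by omega)
      have hni : i + 1 ∉ S := fun hm => by have := Finset.mem_Icc.1 (hS hm); omega
      -- An improvement makes `R (l - p) - w (i + 1)` positive while `R (l - p) ≤ a + 1`, so the
      -- item fits. Items that do not fit never change the table, and their `p` may be arbitrary.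
      obtain rfl := hp (by omega)
      refine ⟨insert (i + 1) S, ?_, ?_, ?_, ?_⟩
      · refine Finset.insert_subset (by simp) (hS.trans (Finset.Icc_subset_Icc le_rfl (by omega)))
      · rw [Finset.sum_insert hni, h1, add_comm]
      · rw [Finset.sum_insert hni]; omega
      · rw [Finset.sum_insert hni, h3]
        have := hi.1
        omega
    · obtain ⟨S, hS, h1⟩ := h.upper l hl
      exact ⟨S, hS.trans (Finset.Icc_subset_Icc le_rfl (by omega)), h1⟩

/-- The entry of largest profit is a good approximation. -/
theorem IsTable.best (h : IsTable w a K i R M) (ha : 0 < a) {l : ℕ} (hl : 0 < R l)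
    (hmax : ∀ l', l < l' → l' ≤ K → R l' = 0) :
    ∃ S ⊆ Finset.Icc 1 i, M l = ∑ t ∈ S, 2 ^ t ∧ ∑ t ∈ S, w t ≤ a ∧
      ∀ V ⊆ Finset.Icc 1 i, ∑ t ∈ V, w t ≤ a → K * ∑ t ∈ V, w t ≤ K * ∑ t ∈ S, w t + i * a := by
  obtain ⟨S, hS, h1, h2, h3⟩ := h.upper l hl
  refine ⟨S, hS, h1, by omega, fun V hV hVa => ?_⟩
  have hv := h.lower V hV hVa
  have h5 := sum_profit_mul_le (w := w) (a := a) (K := K) V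
  have h6 := le_sum_profit_mul (w := w) (K := K) ha V
  have h7 := sum_profit_mul_le (w := w) (a := a) (K := K) S
  have hK : ∑ t ∈ V, profit w a K t ≤ K := by
    have h2 : K * ∑ t ∈ V, w t ≤ K * a := Nat.mul_le_mul_left _ hVa
    rw [mul_comm K a] at h2
    exact Nat.le_of_mul_le_mul_left (h5.trans h2) ha
  -- The entry at the profit of a set within the capacity is positive, so this profit cannot exceed
  -- the last positive index.
  have hle : ∑ t ∈ V, profit w a K t ≤ l := by
    by_contra hc
    have := hmax _ (not_le.1 hc) hK
    omega
  have hcard : V.card ≤ i := by simpa using Finset.card_le_card hV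
  have h8 : a * ∑ t ∈ V, profit w a K t ≤ a * ∑ t ∈ S, profit w a K t :=
    Nat.mul_le_mul_left _ (hle.trans h3.ge)
  have h9 : V.card * a ≤ i * a := Nat.mul_le_mul_right _ hcard
  omega

/-- The largest element of a set of numbers can be read off its bit mask. -/
theorem two_pow_le_sum_iff {S : Finset ℕ} {i : ℕ} (hS : S ⊆ Finset.Icc 1 i) :
    2 ^ i ≤ ∑ t ∈ S, 2 ^ t ↔ i ∈ S := by
  constructor
  · intro h
    by_contra hi
    have : ∑ t ∈ S, 2 ^ t < 2 ^ i := by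
      refine Nat.geomSum_lt (le_refl 2) fun t ht => ?_
      have h1 := Finset.mem_Icc.1 (hS ht)
      have h2 : t ≠ i := fun h => hi (h ▸ ht)
      omega
    omega
  · intro h
    exact Finset.single_le_sum (f := fun t => 2 ^ t) (fun _ _ => Nat.zero_le _) h

end RoundedSubsetSum

/-! ### Total correctness of programs -/

namespace RAM

@[simp] theorem State.setReg_reg (s : State) (r v x : ℕ) :
    (s.setReg r v).reg x = if x = r then v else s.reg x := by
  simp [State.setReg, Function.update_apply]

@[simp] theorem State.setReg_arr (s : State) (r v : ℕ) : (s.setReg r v).arr = s.arr := rfl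

@[simp] theorem State.setArr_reg (s : State) (a i v : ℕ) : (s.setArr a i v).reg = s.reg := rfl

@[simp] theorem State.setArr_arr (s : State) (a i v b j : ℕ) :
    (s.setArr a i v).arr b j = if b = a then (if j = i then v else s.arr b j) else s.arr b j := by
  simp only [State.setArr, Function.update_apply]
  split_ifs with h1 h2 <;> simp_all

/-- Started in state `s`, the program `P` halts after at most `T` steps in a state that
satisfies `Q`. -/
def Halts (P : Program) (s : State) (T : ℕ) (Q : State → Prop) : Prop :=
  ∃ s' t, Exec P s s' t ∧ t ≤ T ∧ Q s'

/-- The weakest precondition of `Q` for a program without loops. -/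
def Program.wp : Program → (State → Prop) → State → Prop
  | .skip, Q, s => Q s
  | .const r k, Q, s => Q (s.setReg r k)
  | .add r x y, Q, s => Q (s.setReg r (s.reg x + s.reg y))
  | .sub r x y, Q, s => Q (s.setReg r (s.reg x - s.reg y))
  | .load r a x, Q, s => Q (s.setReg r (s.arr a (s.reg x)))
  | .store a x y, Q, s => Q (s.setArr a (s.reg x) (s.reg y))
  | .seq P P', Q, s => P.wp (P'.wp Q) s
  | .ifPos x P P', Q, s => (0 < s.reg x → P.wp Q s) ∧ (s.reg x = 0 → P'.wp Q s)
  | .loop _ _, _, _ => False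

/-- A bound on the number of steps of a program without loops. -/
def Program.steps : Program → ℕ
  | .seq P Q => P.steps + Q.steps
  | .ifPos _ P Q => max P.steps Q.steps + 1
  | _ => 1

theorem Halts.steps_of_wp {P : Program} {s : State} {Q : State → Prop} (h : P.wp Q s) :
    Halts P s P.steps Q := by
  induction P generalizing s Q with
  | skip => exact ⟨_, 1, .skip s, le_rfl, h⟩
  | const r k => exact ⟨_, 1, .const s r k, le_rfl, h⟩
  | add r x y => exact ⟨_, 1, .add s r x y, le_rfl, h⟩
  | sub r x y => exact ⟨_, 1, .sub s r x y, le_rfl, h⟩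
  | load r a x => exact ⟨_, 1, .load s r a x, le_rfl, h⟩
  | store a x y => exact ⟨_, 1, .store s a x y, le_rfl, h⟩
  | seq P P' ih ih' =>
    obtain ⟨s', t, he, ht, hq⟩ := ih h
    obtain ⟨s'', t', he', ht', hq'⟩ := ih' hq
    exact ⟨s'', t + t', .seq he he', Nat.add_le_add ht ht', hq'⟩
  | ifPos x P P' ih ih' =>
    rcases Nat.eq_zero_or_pos (s.reg x) with hx | hx
    · obtain ⟨s', t, he, ht, hq⟩ := ih' (h.2 hx)
      exact ⟨s', t + 1, .ifPos_zero hx he,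
        Nat.add_le_add (ht.trans (le_max_right _ _)) le_rfl, hq⟩
    · obtain ⟨s', t, he, ht, hq⟩ := ih (h.1 hx)
      exact ⟨s', t + 1, .ifPos_pos hx he,
        Nat.add_le_add (ht.trans (le_max_left _ _)) le_rfl, hq⟩
  | loop x P => exact h.elim

theorem Halts.mono {P : Program} {s : State} {T T' : ℕ} {Q Q' : State → Prop}
    (h : Halts P s T Q) (hT : T ≤ T') (hQ : ∀ s', Q s' → Q' s') : Halts P s T' Q' := by
  obtain ⟨s', t, he, ht, hq⟩ := h
  exact ⟨s', t, he, ht.trans hT, hQ s' hq⟩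

theorem Halts.of_wp {P : Program} {s : State} {T : ℕ} {Q : State → Prop} (hT : P.steps ≤ T)
    (h : P.wp Q s) : Halts P s T Q :=
  (Halts.steps_of_wp h).mono hT fun _ h => h

theorem Halts.seq {P P' : Program} {s : State} {T T' : ℕ} {Q Q' : State → Prop}
    (h : Halts P s T Q) (h' : ∀ s', Q s' → Halts P' s' T' Q') :
    Halts (.seq P P') s (T + T') Q' := by
  obtain ⟨s', t, he, ht, hq⟩ := h
  obtain ⟨s'', t', he', ht', hq'⟩ := h' s' hq
  exact ⟨s'', t + t', .seq he he', Nat.add_le_add ht ht', hq'⟩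

/-- The rule for loops: `Inv m` is the invariant when at most `m` rounds remain. -/
theorem Halts.loop {x : ℕ} {P : Program} {T : ℕ} (Inv : ℕ → State → Prop)
    (hstep : ∀ m s, Inv m s → 0 < s.reg x → ∃ m', m = m' + 1 ∧ Halts P s T (Inv m'))
    {m : ℕ} {s : State} (h : Inv m s) :
    Halts (.loop x P) s (m * (T + 1) + 1) fun s' => (∃ m', Inv m' s') ∧ s'.reg x = 0 := by
  induction m generalizing s with
  | zero =>
    have hx : s.reg x = 0 := by
      by_contra hc
      obtain ⟨m', hm', -⟩ := hstep 0 s h (Nat.pos_of_ne_zero hc)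
      omega
    exact ⟨s, 1, .loop_zero hx, by omega, ⟨0, h⟩, hx⟩
  | succ m ih =>
    by_cases hx : s.reg x = 0
    · exact ⟨s, 1, .loop_zero hx, by omega, ⟨m + 1, h⟩, hx⟩
    · obtain ⟨m', hm', s', t, he, ht, hi⟩ := hstep _ s h (Nat.pos_of_ne_zero hx)
      obtain rfl : m = m' := by omega
      obtain ⟨s'', t', he', ht', hq⟩ := ih hi
      refine ⟨s'', t + t' + 1, .loop_pos (Nat.pos_of_ne_zero hx) he he', ?_, hq⟩
      rw [Nat.succ_mul]
      omega

/-- The rule for loops that count register `x` down to zero. -/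
theorem Halts.countdown {x : ℕ} {P : Program} {T : ℕ} (Inv : ℕ → State → Prop)
    (hx : ∀ m s, Inv m s → s.reg x = m)
    (hstep : ∀ m s, Inv (m + 1) s → Halts P s T (Inv m))
    {m : ℕ} {s : State} (h : Inv m s) :
    Halts (.loop x P) s (m * (T + 1) + 1) (Inv 0) := by
  refine (Halts.loop Inv (fun m s hi hp => ?_) h).mono le_rfl ?_
  · rw [hx m s hi] at hp
    obtain ⟨m', rfl⟩ : ∃ m', m = m' + 1 := ⟨m - 1, by omega⟩
    exact ⟨m', rfl, hstep m' s hi⟩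
  · rintro s' ⟨⟨m', hi⟩, h0⟩
    rw [hx m' s' hi] at h0
    exact h0 ▸ hi

end RAM

/-! ### The approximation scheme as a program -/

namespace StarFPTAS

open RAM RoundedSubsetSum

infixr:60 " ;; " => RAM.Program.seq

/-- The registers outside `L` have the same content in `s` and `s'`. -/
def AgreeOff (L : List ℕ) (s s' : State) : Prop := ∀ r, r ∉ L → s'.reg r = s.reg r

/-- One round of the computation of the profit of an item: register `9` holds the remainder,
register `15` the weight, register `3` the capacity, register `19` the profit. -/
def profitBody : Program :=
  .add 9 9 15 ;; .add 16 9 1 ;; .sub 16 16 3 ;;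
    .ifPos 16 (.sub 9 9 3 ;; .add 19 19 1) .skip ;; .sub 20 20 1

/-- Multiplication and division run together: each of `K` rounds adds `w` to the remainder and
subtracts `a` at most once. If `w ≤ a`, the remainder was below `a` and is below `2 * a` after the
addition, so one subtraction suffices. For larger `w` only the bound `K` is kept. -/
theorem profit_spec {s : State} {a K w : ℕ} (h1 : s.reg 1 = 1) (h3 : s.reg 3 = a)
    (h9 : s.reg 9 = 0) (h15 : s.reg 15 = w) (h19 : s.reg 19 = 0) (h20 : s.reg 20 = K)
    (ha : 0 < a) :
    Halts (.loop 20 profitBody) s (K * 8 + 1) fun s' =>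
      AgreeOff [9, 16, 19, 20] s s' ∧ s'.arr = s.arr ∧ s'.reg 19 ≤ K ∧
      (w ≤ a → s'.reg 19 = K * w / a) := by
  refine (Halts.countdown (T := 7) (fun m s' => s'.reg 20 = m ∧ AgreeOff [9, 16, 19, 20] s s' ∧
    s'.arr = s.arr ∧ s'.reg 19 + m ≤ K ∧
    (w ≤ a → s'.reg 9 + s'.reg 19 * a + m * w = K * w ∧ s'.reg 9 < a))
    (fun m s' h => h.1) ?_ (m := K) ?_).mono le_rfl ?_
  · rintro m s' ⟨i1, i2, i3, i4, i5⟩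
    refine Halts.of_wp (by decide) ?_
    have k1 : s'.reg 1 = 1 := by rw [i2 1 (by simp), h1]
    have k3 : s'.reg 3 = a := by rw [i2 3 (by simp), h3]
    have k15 : s'.reg 15 = w := by rw [i2 15 (by simp), h15]
    simp only [profitBody, Program.wp, reduceIte, Nat.reduceEqDiff, State.setReg_reg,
      State.setReg_arr, i1, k1, k3, k15]
    refine ⟨fun hc => ⟨by simp, ?_, i3, ?_, fun hw => ?_⟩,
      fun hc => ⟨by simp, ?_, i3, ?_, fun hw => ?_⟩⟩
    · intro r hr
      have := i2 r hr
      simp only [List.mem_cons, List.not_mem_nil, or_false, not_or] at hr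
      simp [hr, this]
    · omega
    · obtain ⟨e1, e2⟩ := i5 hw
      constructor
      · rw [Nat.succ_mul] at e1 ⊢
        omega
      · omega
    · intro r hr
      have := i2 r hr
      simp only [List.mem_cons, List.not_mem_nil, or_false, not_or] at hr
      simp [hr, this]
    · omega
    · obtain ⟨e1, e2⟩ := i5 hw
      constructor
      · rw [Nat.succ_mul] at e1
        omega
      · omega
  · refine ⟨h20, fun r _ => rfl, rfl, by omega, fun _ => ?_⟩
    rw [h9, h19]
    omega
  · rintro s' ⟨i1, i2, i3, i4, i5⟩
    refine ⟨i2, i3, by omega, fun hw => ?_⟩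
    obtain ⟨e1, e2⟩ := i5 hw
    symm
    rw [Nat.div_eq_iff ha]
    omega

/-- One round of the update of the tables: register `21` holds the index, register `15` the weight,
register `19` the profit and register `12` the bit of the item. -/
def tableBody : Program :=
  .sub 21 21 1 ;; .load 22 2 21 ;; .sub 22 22 15 ;; .add 13 21 19 ;; .load 23 2 13 ;;
    .sub 16 22 23 ;;
    .ifPos 16 (.store 2 13 22 ;; .load 23 3 21 ;; .add 23 23 12 ;; .store 3 13 23) .skip

/-- The update is done in place from high indices to low. When the source `m` and target `m + p` are
read, only entries above `m + p` may have changed, so both still hold the old table and the item is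
used at most once. -/
theorem table_spec {s : State} {K w p b : ℕ} (h1 : s.reg 1 = 1) (h12 : s.reg 12 = b)
    (h15 : s.reg 15 = w) (h19 : s.reg 19 = p) (h21 : s.reg 21 = K - p + 1) (hp : p ≤ K) :
    Halts (.loop 21 tableBody) s ((K + 1) * 12 + 1) fun s' =>
      AgreeOff [13, 16, 21, 22, 23] s s' ∧ (∀ c, c ≠ 2 → c ≠ 3 → s'.arr c = s.arr c) ∧
      s'.arr 2 = nextR K p w (s.arr 2) ∧ s'.arr 3 = nextM K p w b (s.arr 2) (s.arr 3) := by
  refine (Halts.countdown (T := 11) (fun m s' => s'.reg 21 = m ∧ m ≤ K - p + 1 ∧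
    AgreeOff [13, 16, 21, 22, 23] s s' ∧ (∀ c, c ≠ 2 → c ≠ 3 → s'.arr c = s.arr c) ∧
    (∀ l, s'.arr 2 l = if p + m ≤ l then nextR K p w (s.arr 2) l else s.arr 2 l) ∧
    (∀ l, s'.arr 3 l = if p + m ≤ l then nextM K p w b (s.arr 2) (s.arr 3) l else s.arr 3 l))
    (fun m s' h => h.1) ?_ (m := K - p + 1) ?_).mono ?_ ?_
  · rintro m s' ⟨i1, i2, i3, i4, i5, i6⟩
    refine Halts.of_wp (by decide) ?_
    have k1 : s'.reg 1 = 1 := by rw [i3 1 (by simp), h1]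
    have k12 : s'.reg 12 = b := by rw [i3 12 (by simp), h12]
    have k15 : s'.reg 15 = w := by rw [i3 15 (by simp), h15]
    have k19 : s'.reg 19 = p := by rw [i3 19 (by simp), h19]
    have r1 : s'.arr 2 m = s.arr 2 m := by rw [i5, if_neg (by omega)]
    have r2 : s'.arr 2 (m + p) = s.arr 2 (m + p) := by rw [i5, if_neg (by omega)]
    have r3 : s'.arr 3 m = s.arr 3 m := by rw [i6, if_neg (by omega)]
    have hiff : Improves K p w (s.arr 2) (m + p) ↔ s.arr 2 (m + p) < s.arr 2 m - w := by
      unfold Improves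
      rw [Nat.add_sub_cancel]
      exact ⟨fun h => h.2.2, fun h => ⟨by omega, by omega, h⟩⟩
    simp only [tableBody, Program.wp, reduceIte, Nat.reduceEqDiff, State.setReg_reg, State.setReg_arr, State.setArr_reg,
      State.setArr_arr, i1, k1, k12, k15, k19, Nat.add_sub_cancel, r1, r2, r3]
    refine ⟨fun hc => ?_, fun hc => ?_⟩
    · have himp := hiff.2 (by simpa using hc)
      refine ⟨by simp, by omega, fun r hr => ?_, fun c hc2 hc3 => ?_, fun l => ?_, fun l => ?_⟩
      · have := i3 r hr
        simp only [List.mem_cons, List.not_mem_nil, or_false, not_or] at hr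
        simp [hr, this]
      · funext l
        simp [hc2, hc3, i4]
      · by_cases hl : l = m + p
        · subst hl
          simp
          rw [if_pos (by omega), nextR, if_pos himp, Nat.add_sub_cancel]
        · simp [hl]
          rw [i5]
          split_ifs <;> first | rfl | (exfalso; omega)
      · by_cases hl : l = m + p
        · subst hl
          simp
          rw [if_pos (by omega), nextM, if_pos himp, Nat.add_sub_cancel]
        · simp [hl]
          rw [i6]
          split_ifs <;> first | rfl | (exfalso; omega)
    · have himp : ¬ Improves K p w (s.arr 2) (m + p) := fun h => by
        have := hiff.1 h
        omega
      refine ⟨by simp, by omega, fun r hr => ?_, i4, fun l => ?_, fun l => ?_⟩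
      · have := i3 r hr
        simp only [List.mem_cons, List.not_mem_nil, or_false, not_or] at hr
        simp [hr, this]
      · by_cases hl : l = m + p
        · subst hl
          rw [r2, if_pos (by omega), nextR, if_neg himp]
        · rw [i5]
          split_ifs <;> first | rfl | (exfalso; omega)
      · by_cases hl : l = m + p
        · subst hl
          rw [i6, if_neg (by omega), if_pos (by omega), nextM, if_neg himp]
        · rw [i6]
          split_ifs <;> first | rfl | (exfalso; omega)
  · refine ⟨h21, le_rfl, fun r _ => rfl, fun _ _ _ => rfl, fun l => ?_, fun l => ?_⟩
    · split_ifs with hl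
      · rw [nextR, if_neg fun h => by have := h.2.1; omega]
      · rfl
    · split_ifs with hl
      · rw [nextM, if_neg fun h => by have := h.2.1; omega]
      · rfl
  · have : (K - p + 1) * (11 + 1) ≤ (K + 1) * 12 := Nat.mul_le_mul_right _ (by omega)
    omega
  · rintro s' ⟨i1, i2, i3, i4, i5, i6⟩
    refine ⟨i3, i4, funext fun l => ?_, funext fun l => ?_⟩
    · rw [i5]
      split_ifs with hl
      · rfl
      · rw [nextR, if_neg fun h => hl (by have := h.1; omega)]
    · rw [i6]
      split_ifs with hl
      · rfl
      · rw [nextM, if_neg fun h => hl (by have := h.1; omega)]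

/-- The largest index at which the table is positive is searched from above. -/
def bestBody : Program := .sub 21 21 1 ;; .load 16 2 21 ;; .sub 16 1 16

/-- Register `16` becomes `1 - R l`, which vanishes exactly at a positive entry. The search stops at
index `0` at the latest, because of `h0`. -/
theorem best_spec {s : State} {K : ℕ} (h1 : s.reg 1 = 1) (h16 : s.reg 16 = 1)
    (h21 : s.reg 21 = K + 1) (h0 : 0 < s.arr 2 0) :
    Halts (.loop 16 bestBody) s ((K + 1) * 4 + 1) fun s' =>
      AgreeOff [16, 21] s s' ∧ s'.arr = s.arr ∧ 0 < s.arr 2 (s'.reg 21) ∧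
      ∀ l, s'.reg 21 < l → l ≤ K → s.arr 2 l = 0 := by
  refine (Halts.loop (T := 3) (fun m s' => s'.reg 21 = m ∧ AgreeOff [16, 21] s s' ∧
    s'.arr = s.arr ∧ (0 < s'.reg 16 → ∀ l, m ≤ l → l ≤ K → s.arr 2 l = 0) ∧
    (s'.reg 16 = 0 → 0 < s.arr 2 m ∧ ∀ l, m < l → l ≤ K → s.arr 2 l = 0))
    ?_ (m := K + 1) ?_).mono le_rfl ?_
  · rintro m s' ⟨i1, i2, i3, i4, i5⟩ hpos
    have j4 := i4 hpos
    rcases m with _ | m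
    · have := j4 0 le_rfl (Nat.zero_le _)
      omega
    refine ⟨m, rfl, Halts.of_wp (by decide) ?_⟩
    have k1 : s'.reg 1 = 1 := by rw [i2 1 (by simp), h1]
    simp only [bestBody, Program.wp, reduceIte, Nat.reduceEqDiff, State.setReg_reg,
      State.setReg_arr, i1, i3, k1,
      Nat.add_sub_cancel]
    refine ⟨by simp, fun r hr => ?_, trivial, ?_, ?_⟩
    · have := i2 r hr
      simp only [List.mem_cons, List.not_mem_nil, or_false, not_or] at hr
      simp [hr, this]
    · simp
      intro h l hl hlK
      rcases hl.lt_or_eq with h2 | rfl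
      · exact j4 l h2 hlK
      · exact h
    · intro h
      exact ⟨by omega, fun l hl hlK => j4 l hl hlK⟩
  · exact ⟨h21, fun r _ => rfl, rfl, fun _ l hl hlK => by omega, fun h => by omega⟩
  · rintro s' ⟨⟨m, i1, i2, i3, i4, i5⟩, h⟩
    subst i1
    exact ⟨i2, i3, i5 h⟩

end StarFPTAS

/-! ### Processing the items: the largest large satellite and the profit table. -/

namespace StarFPTAS

open RAM RoundedSubsetSum

/-- What the main part of the program knows about the input: `n` satellites, stretch factors `c`,
and `K` units of profit. -/
structure Context (n K : ℕ) (c : ℕ → ℕ) (s : State) : Prop where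
  reg0 : s.reg 0 = 0
  reg1 : s.reg 1 = 1
  reg2 : s.reg 2 = n
  reg3 : s.reg 3 = c 0
  reg4 : s.reg 4 = K
  reg7 : s.reg 7 = 3
  reg8 : s.reg 8 = 3 * c 0
  input : ∀ t ≤ n, s.arr 0 (3 + t) = c t

theorem Context.of_agree {n K : ℕ} {c : ℕ → ℕ} {s s' : State} {L : List ℕ}
    (h : Context n K c s) (hL : ∀ r ∈ [0, 1, 2, 3, 4, 7, 8], r ∉ L) (hs : AgreeOff L s s')
    (ha : s'.arr 0 = s.arr 0) : Context n K c s' where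
  reg0 := by rw [hs 0 (hL 0 (by simp)), h.reg0]
  reg1 := by rw [hs 1 (hL 1 (by simp)), h.reg1]
  reg2 := by rw [hs 2 (hL 2 (by simp)), h.reg2]
  reg3 := by rw [hs 3 (hL 3 (by simp)), h.reg3]
  reg4 := by rw [hs 4 (hL 4 (by simp)), h.reg4]
  reg7 := by rw [hs 7 (hL 7 (by simp)), h.reg7]
  reg8 := by rw [hs 8 (hL 8 (by simp)), h.reg8]
  input t ht := by rw [ha, h.input t ht]

/-- A satellite of stretch factor `x` that can be interleaved with, or can contain, the central task
of stretch factor `a`. -/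
def Large (a x : ℕ) : Prop := x = a ∨ 3 * a ≤ x

/-- `r` is a large satellite of maximal stretch factor among `1, …, i`, and `x` is its stretch
factor; both are zero if there is no large satellite. -/
def IsLargest (c : ℕ → ℕ) (i r x : ℕ) : Prop :=
  (r = 0 ∧ x = 0 ∧ ∀ t, 1 ≤ t → t ≤ i → ¬ Large (c 0) (c t)) ∨
  (1 ≤ r ∧ r ≤ i ∧ x = c r ∧ Large (c 0) (c r) ∧
    ∀ t, 1 ≤ t → t ≤ i → Large (c 0) (c t) → c t ≤ c r)

theorem IsLargest.update {c : ℕ → ℕ} {i r x : ℕ} (h : IsLargest c i r x)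
    (hL : Large (c 0) (c (i + 1))) (hx : x < c (i + 1)) :
    IsLargest c (i + 1) (i + 1) (c (i + 1)) := by
  refine .inr ⟨by omega, le_rfl, rfl, hL, fun t h1 h2 ht => ?_⟩
  rcases Nat.lt_or_ge i t with h3 | h3
  · rw [show t = i + 1 by omega]
  · rcases h with ⟨-, -, h⟩ | ⟨-, -, h4, -, h⟩
    · exact absurd ht (h t h1 h3)
    · have := h t h1 h3 ht
      omega

theorem IsLargest.keep {c : ℕ → ℕ} {i r x : ℕ} (h : IsLargest c i r x) (h0 : 0 < c 0)
    (hL : Large (c 0) (c (i + 1)) → c (i + 1) ≤ x) : IsLargest c (i + 1) r x := by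
  rcases h with ⟨hr, hx, h⟩ | ⟨h1, h2, h3, h4, h⟩
  · refine .inl ⟨hr, hx, fun t h1 h2 ht => ?_⟩
    rcases Nat.lt_or_ge i t with h3 | h3
    · obtain rfl : t = i + 1 := by omega
      have h4 := hL ht
      rcases ht with ht | ht <;> omega
    · exact h t h1 h3 ht
  · refine .inr ⟨h1, by omega, h3, h4, fun t h5 h6 ht => ?_⟩
    rcases Nat.lt_or_ge i t with h7 | h7
    · obtain rfl : t = i + 1 := by omega
      have := hL ht
      omega
    · exact h t h5 h7 ht

/-- Fetch the next item. -/
def itemHead : Program :=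
  .add 11 11 1 ;; .add 12 12 12 ;; .store 4 11 12 ;; .add 13 7 11 ;; .load 14 0 13 ;;
    .add 15 14 14 ;; .add 15 15 14 ;; .const 9 0 ;; .const 19 0 ;; .add 20 4 0

/-- Update the large satellite of maximal stretch factor. -/
def largestUpdate : Program :=
  .sub 16 8 14 ;; .ifPos 16 (.sub 16 3 14 ;; .sub 27 14 3 ;; .add 16 16 27) .skip ;;
    .ifPos 16 .skip (.sub 16 14 17 ;; .ifPos 16 (.add 18 11 0 ;; .add 17 14 0) .skip)

/-- The test register is zero exactly for a large item `x`: it holds `3 * a - x`, and if that is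
positive it is replaced by `(a - x) + (x - a)`, the distance from `x` to `a`. Since `a` is positive,
the first large item beats the initial value `0`. -/
theorem largestUpdate_spec {n K i : ℕ} {c : ℕ → ℕ} {s : State} (h : Context n K c s)
    (h0 : 0 < c 0) (h14 : s.reg 14 = c (i + 1)) (h11 : s.reg 11 = i + 1)
    (hl : IsLargest c i (s.reg 18) (s.reg 17)) :
    Halts largestUpdate s 12 fun s' => AgreeOff [16, 17, 18, 27] s s' ∧ s'.arr = s.arr ∧
      IsLargest c (i + 1) (s'.reg 18) (s'.reg 17) := by
  refine Halts.of_wp (by decide) ?_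
  simp only [largestUpdate, Program.wp, reduceIte, Nat.reduceEqDiff, State.setReg_reg,
    State.setReg_arr, h.reg0, h.reg3, h.reg8, h14, h11, Nat.add_zero]
  have agree : ∀ s', (∀ r, r ≠ 16 ∧ r ≠ 17 ∧ r ≠ 18 ∧ r ≠ 27 → s'.reg r = s.reg r) →
      AgreeOff [16, 17, 18, 27] s s' := fun s' h r hr => h r (by simpa using hr)
  refine ⟨fun h1 => ⟨fun h2 => ?_, fun h2 => ⟨fun h3 => ?_, fun h3 => ?_⟩⟩,
    fun h1 => ⟨fun h2 => ?_, fun h2 => ⟨fun h3 => ?_, fun h3 => ?_⟩⟩⟩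
  · refine ⟨agree _ fun r hr => by simp [hr], trivial, ?_⟩
    exact hl.keep h0 fun h => by rcases h with h | h <;> omega
  · refine ⟨agree _ fun r hr => by simp [hr], trivial, ?_⟩
    exact hl.update (.inl (by omega)) (by omega)
  · refine ⟨agree _ fun r hr => by simp [hr], trivial, ?_⟩
    exact hl.keep h0 fun h => by omega
  · omega
  · refine ⟨agree _ fun r hr => by simp [hr], trivial, ?_⟩
    exact hl.update (.inr (by omega)) (by omega)
  · refine ⟨agree _ fun r hr => by simp [hr], trivial, ?_⟩
    exact hl.keep h0 fun h => by omega

/-- The invariant of the loop over the items, when `m` items remain. -/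
structure ItemsInv (n K : ℕ) (c : ℕ → ℕ) (m : ℕ) (s : State) : Prop where
  context : Context n K c s
  counter : s.reg 10 = m
  index : s.reg 11 + m = n
  bit : s.reg 12 = 2 ^ s.reg 11
  bits : ∀ t, 1 ≤ t → t ≤ s.reg 11 → s.arr 4 t = 2 ^ t
  table : IsTable (fun t => 3 * c t) (c 0) K (s.reg 11) (s.arr 2) (s.arr 3)
  largest : IsLargest c (s.reg 11) (s.reg 18) (s.reg 17)

/-- One round of the loop over the items. -/
def itemBody : Program :=
  itemHead ;; largestUpdate ;; .loop 20 profitBody ;; (.sub 21 4 19 ;; .add 21 21 1) ;;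
    .loop 21 tableBody ;; .sub 10 10 1

theorem item_spec {n K m : ℕ} {c : ℕ → ℕ} {s : State} (h : ItemsInv n K c (m + 1) s)
    (h0 : 0 < c 0) : Halts itemBody s (20 * K + 39) (ItemsInv n K c m) := by
  obtain ⟨hC, h10, h11, h12, h4, hT, hL⟩ := h
  set i := s.reg 11 with hi
  have hin : s.arr 0 (3 + (i + 1)) = c (i + 1) := hC.input _ (by omega)
  refine (Halts.seq (T := 10) (T' := 20 * K + 29) (Q := fun s' => Context n K c s' ∧
    s'.reg 10 = m + 1 ∧ s'.reg 11 = i + 1 ∧ s'.reg 12 = 2 ^ (i + 1) ∧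
    s'.reg 14 = c (i + 1) ∧ s'.reg 15 = 3 * c (i + 1) ∧ s'.reg 9 = 0 ∧ s'.reg 19 = 0 ∧
    s'.reg 20 = K ∧ s'.reg 17 = s.reg 17 ∧ s'.reg 18 = s.reg 18 ∧
    (∀ t, 1 ≤ t → t ≤ i + 1 → s'.arr 4 t = 2 ^ t) ∧ s'.arr 2 = s.arr 2 ∧ s'.arr 3 = s.arr 3)
    ?_ ?_).mono (by omega) fun _ h => h
  · refine Halts.of_wp (by decide) ?_
    simp only [itemHead, Program.wp, reduceIte, Nat.reduceEqDiff, State.setReg_reg,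
      State.setReg_arr, State.setArr_reg, State.setArr_arr, hC.reg0, hC.reg1, hC.reg4, hC.reg7,
      ← hi, h12, hin, h10, Nat.add_zero]
    refine ⟨?_, trivial, trivial, by ring, trivial, by ring, trivial, trivial, trivial, trivial,
      trivial, fun t ht1 ht2 => ?_, ?_, ?_⟩
    · constructor <;> simp [hC.reg0, hC.reg1, hC.reg2, hC.reg3, hC.reg4, hC.reg7, hC.reg8]
      exact hC.input
    · split_ifs with ht
      · subst ht; ring
      · exact h4 t ht1 (by omega)
    · funext l; simp
    · funext l; simp
  rintro s1 ⟨hC1, a10, a11, a12, a14, a15, a9, a19, a20, a17, a18, a4, a2, a3⟩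
  refine (Halts.seq (T := 12) (T' := 20 * K + 17)
    (largestUpdate_spec hC1 h0 a14 a11 (by rw [a17, a18]; exact hL)) ?_).mono (by omega)
    fun _ h => h
  rintro s2 ⟨b, barr, bL⟩
  have hC2 := hC1.of_agree (by simp) b (by rw [barr])
  refine (Halts.seq (T := K * 8 + 1) (T' := 12 * K + 16)
    (profit_spec hC2.reg1 hC2.reg3 (by rw [b 9 (by simp), a9]) (by rw [b 15 (by simp), a15])
      (by rw [b 19 (by simp), a19]) (by rw [b 20 (by simp), a20]) h0) ?_).mono (by omega)
    fun _ h => h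
  rintro s3 ⟨d, darr, dK, dp⟩
  have hC3 := hC2.of_agree (by simp) d (by rw [darr])
  set p := s3.reg 19 with hp
  refine (Halts.seq (T := 2) (T' := 12 * K + 14) (Q := fun s' => AgreeOff [21] s3 s' ∧
    s'.arr = s3.arr ∧ s'.reg 21 = K - p + 1) ?_ ?_).mono (by omega) fun _ h => h
  · refine Halts.of_wp (by decide) ?_
    simp only [Program.wp, reduceIte, Nat.reduceEqDiff, State.setReg_reg, State.setReg_arr,
      hC3.reg1, hC3.reg4, ← hp]
    refine ⟨fun r hr => ?_, trivial, trivial⟩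
    simp only [List.mem_cons, List.not_mem_nil, or_false] at hr
    simp [hr]
  rintro s4 ⟨e, earr, e21⟩
  have hC4 := hC3.of_agree (by simp) e (by rw [earr])
  refine (Halts.seq (T := (K + 1) * 12 + 1) (T' := 1)
    (table_spec (b := 2 ^ (i + 1)) (w := 3 * c (i + 1)) hC4.reg1
      (by rw [e 12 (by simp), d 12 (by simp), b 12 (by simp), a12])
      (by rw [e 15 (by simp), d 15 (by simp), b 15 (by simp), a15])
      (by rw [e 19 (by simp)]) e21 dK) ?_).mono (by omega) fun _ h => h
  rintro s5 ⟨f, farr, f2, f3⟩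
  have hC5 := hC4.of_agree (by simp) f (farr 0 (by simp) (by simp))
  have g10 : s5.reg 10 = m + 1 := by
    rw [f 10 (by simp), e 10 (by simp), d 10 (by simp), b 10 (by simp), a10]
  have g11 : s5.reg 11 = i + 1 := by
    rw [f 11 (by simp), e 11 (by simp), d 11 (by simp), b 11 (by simp), a11]
  have g12 : s5.reg 12 = 2 ^ (i + 1) := by
    rw [f 12 (by simp), e 12 (by simp), d 12 (by simp), b 12 (by simp), a12]
  have g17 : s5.reg 17 = s2.reg 17 := by
    rw [f 17 (by simp), e 17 (by simp), d 17 (by simp)]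
  have g18 : s5.reg 18 = s2.reg 18 := by
    rw [f 18 (by simp), e 18 (by simp), d 18 (by simp)]
  rw [earr, darr, barr, a2] at f2
  rw [earr, darr, barr, a2, a3] at f3
  refine Halts.of_wp (by decide) ?_
  simp only [Program.wp, hC5.reg1, g10]
  refine ⟨hC5.of_agree (L := [10]) (by simp) (fun r hr => ?_) rfl, ?_, ?_, ?_, ?_, ?_, ?_⟩
  · simp only [List.mem_cons, List.not_mem_nil, or_false] at hr
    simp [hr]
  · simp
  · simp [g11]; omega
  · simp [g11, g12]
  · simp only [State.setReg_reg, State.setReg_arr, reduceIte, Nat.reduceEqDiff, g11]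
    intro t ht1 ht2
    rw [farr 4 (by simp) (by simp), earr, darr, barr]
    exact a4 t ht1 ht2
  · simp only [State.setReg_reg, State.setReg_arr, reduceIte, Nat.reduceEqDiff, g11, f2, f3]
    -- `dp` guarantees the computed profit only for an item that fits, which is all that
    -- `IsTable.next` requires.
    exact hT.next h0 dp
  · simp only [State.setReg_reg, reduceIte, Nat.reduceEqDiff, g11, g17, g18]
    exact bL

/-! #### Writing the schedule -/

/-- The time needed for the satellites of `S` whose index is larger than `t`. -/
def above (c : ℕ → ℕ) (S : Finset ℕ) (t : ℕ) : ℕ := ∑ u ∈ S.filter (t < ·), 3 * c u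

/-- The satellites that are neither in `S` nor equal to `r`. -/
def others (n : ℕ) (S : Finset ℕ) (r : ℕ) : Finset ℕ :=
  (Finset.Icc 1 n).filter fun u => u ∉ S ∧ u ≠ r

/-- The start time of satellite `t`. -/
def place (n : ℕ) (c : ℕ → ℕ) (S : Finset ℕ) (r B t : ℕ) : ℕ :=
  if t ∈ S then c 0 + above c S t else if t = r then 0 else B + above c (others n S r) t

/-- This recursion lets the output loop, which runs through the indices downwards, keep each
completion time by one addition. -/
theorem above_eq (c : ℕ → ℕ) (S : Finset ℕ) (m : ℕ) :
    above c S m = (if m + 1 ∈ S then 3 * c (m + 1) else 0) + above c S (m + 1) := by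
  unfold above
  split_ifs with h
  · have e : S.filter (m < ·) = insert (m + 1) (S.filter (m + 1 < ·)) := by
      ext t
      simp only [Finset.mem_filter, Finset.mem_insert]
      constructor
      · rintro ⟨h1, h2⟩
        rcases Nat.eq_or_lt_of_le (Nat.succ_le_of_lt h2) with h3 | h3
        · exact .inl h3.symm
        · exact .inr ⟨h1, h3⟩
      · rintro (rfl | ⟨h1, h2⟩)
        · exact ⟨h, by omega⟩
        · exact ⟨h1, by omega⟩
    rw [e, Finset.sum_insert (by simp)]
  · rw [zero_add]
    congr 1
    ext t
    simp only [Finset.mem_filter]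
    refine and_congr_right fun h1 => ⟨fun h2 => ?_, fun h2 => by omega⟩
    have : t ≠ m + 1 := fun h3 => h (h3 ▸ h1)
    omega

theorem sum_filter_le_succ (S : Finset ℕ) (m : ℕ) :
    ∑ t ∈ S.filter (· ≤ m + 1), 2 ^ t =
      (if m + 1 ∈ S then 2 ^ (m + 1) else 0) + ∑ t ∈ S.filter (· ≤ m), 2 ^ t := by
  split_ifs with h
  · rw [← Finset.sum_insert (by simp)]
    congr 1
    ext t
    simp only [Finset.mem_filter, Finset.mem_insert]
    constructor
    · rintro ⟨h1, h2⟩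
      rcases Nat.eq_or_lt_of_le h2 with h3 | h3
      · exact .inl h3
      · exact .inr ⟨h1, by omega⟩
    · rintro (rfl | ⟨h1, h2⟩)
      · exact ⟨h, by omega⟩
      · exact ⟨h1, by omega⟩
  · rw [zero_add]
    congr 1
    ext t
    simp only [Finset.mem_filter]
    refine and_congr_right fun h1 => ⟨fun h2 => ?_, fun h2 => by omega⟩
    have : t ≠ m + 1 := fun h3 => h (h3 ▸ h1)
    omega

/-- One round of the loop that writes the start times: register `24` holds the bit mask of the
satellites in the idle time of the central task, registers `25` and `26` the two completion times,
register `18` the satellite that starts at time zero. -/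
def outBody : Program :=
  .add 13 7 11 ;; .load 14 0 13 ;; .add 15 14 14 ;; .add 15 15 14 ;; .load 22 4 11 ;;
    .add 16 24 1 ;; .sub 16 16 22 ;;
    .ifPos 16 (.sub 24 24 22 ;; .store 1 11 25 ;; .add 25 25 15)
      (.sub 16 11 18 ;; .sub 27 18 11 ;; .add 16 16 27 ;;
        .ifPos 16 (.store 1 11 26 ;; .add 26 26 15) (.store 1 11 0)) ;;
    .sub 11 11 1

/-- The invariant of the loop that writes the start times. -/
structure OutInv (n K : ℕ) (c : ℕ → ℕ) (S : Finset ℕ) (r B x m : ℕ) (s : State) : Prop where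
  context : Context n K c s
  index : s.reg 11 = m
  index_le : m ≤ n
  large : s.reg 18 = r
  bits : ∀ t, 1 ≤ t → t ≤ n → s.arr 4 t = 2 ^ t
  mask : s.reg 24 = ∑ t ∈ S.filter (· ≤ m), 2 ^ t
  top : s.reg 25 = c 0 + above c S m
  top' : s.reg 26 = B + above c (others n S r) m
  out_zero : s.arr 1 0 = x
  out : ∀ t, m < t → t ≤ n → s.arr 1 t = place n c S r B t

/-- The mask keeps only bits up to the current index, so comparing it with the top power of two
decides membership without division. Subtracting that power restores the invariant. -/
theorem out_spec {n K r B x m : ℕ} {c : ℕ → ℕ} {S : Finset ℕ} {s : State}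
    (hS : S ⊆ Finset.Icc 1 n) (h : OutInv n K c S r B x (m + 1) s) :
    Halts outBody s 16 (OutInv n K c S r B x m) := by
  obtain ⟨hC, h11, hmn, h18, h4, h24, h25, h26, hx, ho⟩ := h
  have hin : s.arr 0 (3 + (m + 1)) = c (m + 1) := hC.input _ hmn
  have hb : s.arr 4 (m + 1) = 2 ^ (m + 1) := h4 _ (by omega) hmn
  have hmem : 2 ^ (m + 1) ≤ s.reg 24 ↔ m + 1 ∈ S := by
    rw [h24, two_pow_le_sum_iff]
    · simp
    · intro t ht
      have h1 := Finset.mem_filter.1 ht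
      have h2 := Finset.mem_Icc.1 (hS h1.1)
      exact Finset.mem_Icc.2 ⟨h2.1, h1.2⟩
  have e24 := sum_filter_le_succ S m
  have e25 := above_eq c S m
  have e26 := above_eq c (others n S r) m
  have hothers : m + 1 ∈ others n S r ↔ m + 1 ∉ S ∧ m + 1 ≠ r := by
    simp [others]
    omega
  refine Halts.of_wp (by decide) ?_
  simp only [outBody, Program.wp, reduceIte, Nat.reduceEqDiff, State.setReg_reg,
    State.setReg_arr, State.setArr_reg, hC.reg0, hC.reg1, hC.reg7, h11, h18,
    hin, hb]
  have agree : ∀ s', (∀ r, r ∉ [11, 13, 14, 15, 16, 22, 24, 25, 26, 27] → s'.reg r = s.reg r) →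
      s'.arr 0 = s.arr 0 → Context n K c s' :=
    fun s' h ha => hC.of_agree (by simp) h ha
  refine ⟨fun h1 => ?_, fun h1 => ⟨fun h2 => ?_, fun h2 => ?_⟩⟩
  · have hm : m + 1 ∈ S := hmem.1 (by omega)
    have hno : m + 1 ∉ others n S r := fun h => (hothers.1 h).1 hm
    rw [if_pos hm] at e24 e25
    rw [if_neg hno] at e26
    refine ⟨agree _ (fun r hr => ?_) ?_, ?_, ?_, ?_, ?_, ?_, ?_, ?_, ?_, ?_⟩
    · simp only [List.mem_cons, List.not_mem_nil, or_false, not_or] at hr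
      simp [hr]
    · funext l; simp
    · simp
    · omega
    · simpa using h18
    · simpa using h4
    · simp; omega
    · simp; omega
    · simp; omega
    · simpa using hx
    · intro t ht1 ht2
      by_cases ht : t = m + 1
      · subst ht
        simp [place, hm, h25]
      · simp [ht]
        exact ho t (by omega) ht2
  · have hm : m + 1 ∉ S := fun h => by have := hmem.2 h; omega
    have hr : m + 1 ≠ r := by omega
    have hno : m + 1 ∈ others n S r := hothers.2 ⟨hm, hr⟩
    rw [if_neg hm] at e24 e25
    rw [if_pos hno] at e26
    refine ⟨agree _ (fun r hr => ?_) ?_, ?_, ?_, ?_, ?_, ?_, ?_, ?_, ?_, ?_⟩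
    · simp only [List.mem_cons, List.not_mem_nil, or_false, not_or] at hr
      simp [hr]
    · funext l; simp
    · simp
    · omega
    · simpa using h18
    · simpa using h4
    · simp; omega
    · simp; omega
    · simp; omega
    · simpa using hx
    · intro t ht1 ht2
      by_cases ht : t = m + 1
      · subst ht
        simp [place, hm, hr, h26]
      · simp [ht]
        exact ho t (by omega) ht2
  · have hm : m + 1 ∉ S := fun h => by have := hmem.2 h; omega
    have hr : m + 1 = r := by omega
    have hno : m + 1 ∉ others n S r := fun h => (hothers.1 h).2 hr
    rw [if_neg hm] at e24 e25
    rw [if_neg hno] at e26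
    refine ⟨agree _ (fun r hr => ?_) ?_, ?_, ?_, ?_, ?_, ?_, ?_, ?_, ?_, ?_⟩
    · simp only [List.mem_cons, List.not_mem_nil, or_false, not_or] at hr
      simp [hr]
    · funext l; simp
    · simp
    · omega
    · simpa using h18
    · simpa using h4
    · simp; omega
    · simp; omega
    · simp; omega
    · simpa using hx
    · intro t ht1 ht2
      by_cases ht : t = m + 1
      · subst ht
        have hm' : r ∉ S := hr ▸ hm
        simp [place, hr, hm']
      · simp [ht]
        exact ho t (by omega) ht2

end StarFPTAS

/-! ### The whole program: units of profit, choice of the schedule, number of steps. -/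

namespace StarFPTAS

open RAM RoundedSubsetSum

/-- Read the input. -/
def readInput : Program :=
  .const 1 1 ;; .load 5 0 0 ;; .load 6 0 1 ;; .const 13 2 ;; .load 2 0 13 ;; .const 7 3 ;;
    .load 3 0 7 ;; .add 8 3 3 ;; .add 8 8 3 ;; .add 9 6 0 ;; .add 10 2 0

/-- Prepare the tables. -/
def initTables : Program := .add 16 3 1 ;; .store 2 0 16 ;; .add 10 2 0 ;; .const 12 1

/-- Prepare the loop that writes the start times. -/
def initOutput : Program :=
  .load 24 3 21 ;; .ifPos 18 (.const 24 0) .skip ;; .add 25 3 0 ;; .add 26 17 17 ;;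
    .add 26 26 17 ;; .add 27 17 8 ;; .sub 27 27 26 ;; .add 26 26 27 ;; .store 1 0 17 ;;
    .add 11 2 0

/-- Compute the number of units of profit. -/
def computeUnits : Program :=
  readInput ;; .loop 10 (.add 9 9 6 ;; .sub 10 10 1) ;; .loop 9 (.sub 9 9 5 ;; .add 4 4 1)

/-- Choose the satellites in the idle time of the central task and write the schedule. -/
def solve : Program :=
  initTables ;; .loop 10 itemBody ;; (.add 21 4 1 ;; .const 16 1) ;; .loop 16 bestBody ;;
    initOutput ;; .loop 11 outBody

/-- The approximation scheme. -/
def program : Program := computeUnits ;; solve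

/-- What the program writes: the satellites of `S` are placed in the idle time of the central task,
or satellite `r` is executed together with the central task. -/
def IsSolution (n K : ℕ) (c : ℕ → ℕ) (out : ℕ → ℕ) : Prop :=
  (∃ S ⊆ Finset.Icc 1 n, (∀ t, 1 ≤ t → t ≤ n → ¬ Large (c 0) (c t)) ∧
    ∑ t ∈ S, 3 * c t ≤ c 0 ∧
    (∀ V ⊆ Finset.Icc 1 n, ∑ t ∈ V, 3 * c t ≤ c 0 →
      K * ∑ t ∈ V, 3 * c t ≤ K * ∑ t ∈ S, 3 * c t + n * c 0) ∧
    out 0 = 0 ∧ ∀ t, 0 < t → t ≤ n → out t = place n c S 0 (3 * c 0) t) ∨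
  ∃ r, 1 ≤ r ∧ r ≤ n ∧ Large (c 0) (c r) ∧
    (∀ t, 1 ≤ t → t ≤ n → Large (c 0) (c t) → c t ≤ c r) ∧
    out 0 = c r ∧
    ∀ t, 0 < t → t ≤ n → out t = place n c ∅ r (max (3 * c r) (c r + 3 * c 0)) t

theorem solve_spec {n K : ℕ} {c : ℕ → ℕ} {s : State} (hC : Context n K c s) (h0 : 0 < c 0)
    (h2 : ∀ l, s.arr 2 l = 0) (h3 : ∀ l, s.arr 3 l = 0) (h11 : s.reg 11 = 0) (h17 : s.reg 17 = 0)
    (h18 : s.reg 18 = 0) :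
    Halts solve s (n * (20 * K + 60) + 4 * K + 30) fun s' => IsSolution n K c s'.output := by
  refine (Halts.seq (T := 4) (T' := n * (20 * K + 60) + 4 * K + 26) (Q := ItemsInv n K c n)
    ?_ ?_).mono (by omega) fun _ h => h
  · refine Halts.of_wp (by decide) ?_
    simp only [initTables, Program.wp, reduceIte, Nat.reduceEqDiff, State.setReg_reg,
      State.setArr_reg, hC.reg0, hC.reg1, hC.reg2, hC.reg3, Nat.add_zero]
    constructor
    · constructor <;> simp [hC.reg0, hC.reg1, hC.reg2, hC.reg3, hC.reg4, hC.reg7, hC.reg8]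
      exact hC.input
    · simp
    · simp [h11]
    · simp [h11]
    · intro t ht1 ht2
      simp [h11] at ht2
      omega
    · simp only [State.setReg_reg, reduceIte, Nat.reduceEqDiff, h11, State.setArr_reg]
      exact isTable_zero (by simp) (fun l hl => by simp [hl, h2]) (by simp [h3])
    · simp only [State.setReg_reg, reduceIte, Nat.reduceEqDiff, h11, State.setArr_reg, h17, h18]
      exact .inl ⟨rfl, rfl, fun t h1 h2 => by omega⟩
  intro s1 i1
  have hmul : n * (20 * K + 60) = n * (20 * K + 40) + n * 20 := by ring
  refine (Halts.seq (T := n * (20 * K + 40) + 1) (T' := n * 20 + 4 * K + 25)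
    (Halts.countdown (ItemsInv n K c) (fun m s h => h.counter) (fun m s h => item_spec h h0) i1)
    ?_).mono (by omega) fun _ h => h
  rintro s2 ⟨hC2, -, j11, -, j4, jT, jL⟩
  rw [Nat.add_zero] at j11
  rw [j11] at j4 jT jL
  refine (Halts.seq (T := 2) (T' := n * 20 + 4 * K + 23) (Q := fun s' => AgreeOff [16, 21] s2 s' ∧
    s'.arr = s2.arr ∧ s'.reg 16 = 1 ∧ s'.reg 21 = K + 1) ?_ ?_).mono (by omega) fun _ h => h
  · refine Halts.of_wp (by decide) ?_
    simp only [Program.wp, reduceIte, Nat.reduceEqDiff, State.setReg_reg, State.setReg_arr,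
      hC2.reg1, hC2.reg4]
    refine ⟨fun r hr => ?_, trivial, trivial, trivial⟩
    simp only [List.mem_cons, List.not_mem_nil, or_false, not_or] at hr
    simp [hr]
  rintro s3 ⟨a, aarr, a16, a21⟩
  have hC3 := hC2.of_agree (by simp) a (by rw [aarr])
  have hpos : 0 < s3.arr 2 0 := by
    have := jT.lower ∅ (by simp) (by simp)
    simp at this
    rw [aarr]
    omega
  refine (Halts.seq (T := (K + 1) * 4 + 1) (T' := n * 20 + 18)
    (best_spec hC3.reg1 a16 a21 hpos) ?_).mono (by omega) fun _ h => h
  rintro s4 ⟨b, barr, b21, bmax⟩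
  have hC4 := hC3.of_agree (by simp) b (by rw [barr])
  rw [aarr] at b21 bmax
  rw [aarr] at barr
  obtain ⟨S, hS, hM, hSa, hbest⟩ := jT.best h0 b21 bmax
  have g18 : s4.reg 18 = s2.reg 18 := by rw [b 18 (by simp), a 18 (by simp)]
  have g17 : s4.reg 17 = s2.reg 17 := by rw [b 17 (by simp), a 17 (by simp)]
  set r := s2.reg 18 with hr
  set x := s2.reg 17 with hx
  -- A large satellite takes precedence over the Subset Sum solution, whose mask is then cleared.
  set S' : Finset ℕ := if 0 < r then ∅ else S with hS'
  have hS'n : S' ⊆ Finset.Icc 1 n := by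
    rw [hS']
    split_ifs
    · simp
    · exact hS
  have hfilter : ∀ m, n ≤ m → S'.filter (· ≤ m) = S' := fun m hm =>
    Finset.filter_true_of_mem fun t ht => by
      have := (Finset.mem_Icc.1 (hS'n ht)).2
      omega
  have habove : ∀ T ⊆ Finset.Icc 1 n, above c T n = 0 := fun T hT => by
    rw [above, Finset.filter_false_of_mem fun t ht => ?_]
    · simp
    · have := (Finset.mem_Icc.1 (hT ht)).2
      omega
  -- The others start once both the special satellite and the central task have ended. Without a
  -- large satellite `x = 0`, so `B = 3 * c 0` and the central task starts at `0`: one formula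
  -- serves both cases.
  set B := max (3 * x) (x + 3 * c 0) with hB
  have hout : Halts initOutput s4 11 (OutInv n K c S' r B x n) := by
    refine Halts.of_wp (by decide) ?_
    simp only [initOutput, Program.wp, reduceIte, Nat.reduceEqDiff, State.setReg_reg,
      hC4.reg0, hC4.reg3, hC4.reg8, g17, g18, Nat.add_zero]
    have agree : ∀ s', (∀ r, r ∉ [11, 24, 25, 26, 27] → s'.reg r = s4.reg r) →
        s'.arr 0 = s4.arr 0 → Context n K c s' :=
      fun s' h ha => hC4.of_agree (by simp) h ha
    refine ⟨fun hc => ⟨agree _ (fun r hr => ?_) ?_, ?_, ?_, ?_, ?_, ?_, ?_, ?_, ?_, ?_⟩,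
      fun hc => ⟨agree _ (fun r hr => ?_) ?_, ?_, ?_, ?_, ?_, ?_, ?_, ?_, ?_, ?_⟩⟩
    · simp only [List.mem_cons, List.not_mem_nil, or_false, not_or] at hr
      simp [hr]
    · funext l; simp
    · simp [hC4.reg0, hC4.reg2]
    · exact le_rfl
    · simpa using g18
    · simpa [barr] using j4
    · rw [hS', if_pos hc]; simp
    · simp [habove _ hS'n]
    · simp [habove (others n S' r) (Finset.filter_subset _ _)]
      omega
    · simp
    · intro t h1 h2
      omega
    · simp only [List.mem_cons, List.not_mem_nil, or_false, not_or] at hr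
      simp [hr]
    · funext l; simp
    · simp [hC4.reg0, hC4.reg2]
    · exact le_rfl
    · simpa using g18
    · simpa [barr] using j4
    · rw [hfilter n le_rfl, hS', if_neg (by omega)]; simp [barr, hM]
    · simp [habove _ hS'n]
    · simp [habove (others n S' r) (Finset.filter_subset _ _)]
      omega
    · simp
    · intro t h1 h2
      omega
  refine (Halts.seq (T := 11) (T' := n * 17 + 1) hout fun s5 i5 =>
    Halts.countdown (T := 16) (OutInv n K c S' r B x) (fun m s h => h.index)
      (fun m s h => out_spec hS'n h) i5).mono (by omega) ?_
  rintro s6 ⟨-, -, -, -, -, -, -, -, hx0, hplace⟩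
  rcases jL with ⟨hr0, hx', hno⟩ | ⟨hr1, hrn, hxr, hrL, hmax⟩
  · refine .inl ⟨S, hS, hno, hSa, hbest, ?_, fun t h1 h2 => ?_⟩
    · rw [State.output, hx0, hx']
    · have := hplace t h1 h2
      rw [hS', hB, hx', hr0] at this
      simpa [State.output] using this
  · refine .inr ⟨r, hr1, hrn, hrL, hmax, ?_, fun t h1 h2 => ?_⟩
    · rw [State.output, hx0, hxr]
    · have := hplace t h1 h2
      rw [hS', hB, if_pos (by omega), hxr] at this
      exact this

/-- `p` is subtracted from `(n + 1) * q` until nothing is left, and the rounds are counted by `K`.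
Their number is controlled by `n` and `q / p` alone, not by the sizes of `p` and `q`. -/
theorem computeUnits_spec {n p q : ℕ} {c : ℕ → ℕ} {s : State} (hp : 0 < p)
    (hreg : ∀ r, s.reg r = 0) (i0 : s.arr 0 0 = p) (i1 : s.arr 0 1 = q) (i2 : s.arr 0 2 = n)
    (hin : ∀ t ≤ n, s.arr 0 (3 + t) = c t) :
    Halts computeUnits s (3 * n + 3 * ((n + 1) * q / p) + 16) fun s' =>
      ∃ K, (n + 1) * q ≤ K * p ∧ K ≤ (n + 1) * q / p + 1 ∧ Context n K c s' ∧ s'.arr = s.arr ∧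
        s'.reg 11 = 0 ∧ s'.reg 17 = 0 ∧ s'.reg 18 = 0 := by
  have hin0 : s.arr 0 3 = c 0 := hin 0 (Nat.zero_le _)
  refine (Halts.seq (T := 11) (T' := 3 * n + 3 * ((n + 1) * q / p) + 5)
    (Q := fun s' => Context n 0 c s' ∧ s'.arr = s.arr ∧ s'.reg 5 = p ∧ s'.reg 6 = q ∧
      s'.reg 9 = q ∧ s'.reg 10 = n ∧ s'.reg 11 = 0 ∧ s'.reg 17 = 0 ∧ s'.reg 18 = 0)
    ?_ ?_).mono (by omega) fun _ h => h
  · refine Halts.of_wp (by decide) ?_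
    simp only [readInput, Program.wp, reduceIte, Nat.reduceEqDiff, State.setReg_reg,
      State.setReg_arr, hreg, i0, i1, i2, hin0, Nat.add_zero]
    refine ⟨?_, trivial, trivial, trivial, trivial, trivial, trivial, trivial, trivial⟩
    constructor <;> simp [hreg]
    · ring
    · exact hin
  rintro s1 ⟨hC1, a, a5, a6, a9, a10, a11, a17, a18⟩
  set Y := (n + 1) * q / p with hY
  refine (Halts.seq (T := n * 3 + 1) (T' := 3 * Y + 4) (Halts.countdown (T := 2) (fun m s' =>
      s'.reg 10 = m ∧ Context n 0 c s' ∧ s'.arr = s.arr ∧ s'.reg 5 = p ∧ s'.reg 6 = q ∧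
      s'.reg 9 + m * q = (n + 1) * q ∧ s'.reg 11 = 0 ∧ s'.reg 17 = 0 ∧ s'.reg 18 = 0)
    (fun m s h => h.1) ?_ ⟨a10, hC1, a, a5, a6, by rw [a9]; ring, a11, a17, a18⟩)
    ?_).mono (by omega) fun _ h => h
  · rintro m s' ⟨b10, hC, b, b5, b6, b9, b11, b17, b18⟩
    refine Halts.of_wp (by decide) ?_
    simp only [Program.wp, reduceIte, Nat.reduceEqDiff, State.setReg_reg,
      State.setReg_arr, b10, b5, b6, b11, b17, b18, hC.reg1]
    refine ⟨by simp, hC.of_agree (L := [9, 10]) (by simp) (fun r hr => ?_) rfl, b, trivial, trivial,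
      ?_, trivial, trivial, trivial⟩
    · simp only [List.mem_cons, List.not_mem_nil, or_false, not_or] at hr
      simp [hr]
    · rw [← b9]; ring
  rintro s2 ⟨-, hC2, b, b5, -, b9, b11, b17, b18⟩
  rw [Nat.zero_mul, Nat.add_zero] at b9
  refine (Halts.loop (T := 2) (m := Y + 1) (fun m s' => ∃ K, K + m = Y + 1 ∧ Context n K c s' ∧
    s'.arr = s.arr ∧ s'.reg 5 = p ∧ s'.reg 9 = (n + 1) * q - K * p ∧ s'.reg 11 = 0 ∧
    s'.reg 17 = 0 ∧ s'.reg 18 = 0) ?_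
    ⟨0, by omega, hC2, b, b5, by omega, b11, b17, b18⟩).mono (by omega) ?_
  · rintro m s' ⟨K, hK, hC, d, d5, d9, d11, d17, d18⟩ hpos
    have hlt : K * p < (n + 1) * q := by omega
    have hKY : K ≤ Y := by
      rw [hY, Nat.le_div_iff_mul_le hp]
      exact hlt.le
    refine ⟨Y - K, by omega, Halts.of_wp (by decide) ⟨K + 1, by omega, ?_⟩⟩
    simp only [reduceIte, Nat.reduceEqDiff, State.setReg_reg,
      State.setReg_arr, d5, d9, d11, d17, d18, hC.reg1, hC.reg4]
    refine ⟨?_, d, trivial, ?_, trivial, trivial, trivial⟩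
    · constructor <;> simp [hC.reg0, hC.reg1, hC.reg2, hC.reg3, hC.reg7, hC.reg8]
      exact hC.input
    · rw [Nat.add_one_mul K p, Nat.sub_sub]
  · rintro s3 ⟨⟨m, K, hK, hC, d, d5, d9, d11, d17, d18⟩, h9⟩
    exact ⟨K, by omega, by omega, hC, d, d11, d17, d18⟩

theorem program_spec {n p q : ℕ} {c : ℕ → ℕ} {s : State} (hp : 0 < p) (h0 : 0 < c 0)
    (hreg : ∀ r, s.reg r = 0) (i0 : s.arr 0 0 = p) (i1 : s.arr 0 1 = q) (i2 : s.arr 0 2 = n)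
    (hin : ∀ t ≤ n, s.arr 0 (3 + t) = c t) (harr : ∀ b l, b ≠ 0 → s.arr b l = 0) :
    Halts program s (90 * ((n + 1) * ((n + 1) * q / p + 1))) fun s' =>
      ∃ K, (n + 1) * q ≤ K * p ∧ IsSolution n K c s'.output := by
  set Y := (n + 1) * q / p with hY
  refine (Halts.seq (T' := n * (20 * (Y + 1) + 60) + 4 * (Y + 1) + 30)
    (computeUnits_spec hp hreg i0 i1 i2 hin) ?_).mono ?_ fun _ h => h
  · rintro s1 ⟨K, hK, hKY, hC, a, a11, a17, a18⟩
    refine (solve_spec hC h0 (fun l => by rw [a, harr _ _ (by simp)])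
      (fun l => by rw [a, harr _ _ (by simp)]) a11 a17 a18).mono ?_ fun s' h => ⟨K, hK, h⟩
    have : n * (20 * K + 60) ≤ n * (20 * (Y + 1) + 60) := Nat.mul_le_mul_left _ (by omega)
    omega
  · nlinarith [Nat.zero_le (n * Y), Nat.zero_le n, Nat.zero_le Y]

end StarFPTAS

/-! ### From numbered satellites back to tasks: the approximation ratio. -/

namespace StarFPTAS

open RAM CoupledTask

/-- The stretch factors of an instance, indexed by natural numbers. -/
def stretch {n : ℕ} (α : Fin (n + 1) → ℕ) (t : ℕ) : ℕ := if h : t < n + 1 then α ⟨t, h⟩ else 0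

/-- A set of tasks given by their numbers. -/
def tasks (n : ℕ) (S : Finset ℕ) : Finset (Fin (n + 1)) := Finset.univ.filter fun t => (t : ℕ) ∈ S

variable {n : ℕ} {α : Fin (n + 1) → ℕ}

@[simp] theorem stretch_val (t : Fin (n + 1)) : stretch α t = α t := by
  rw [stretch, dif_pos t.2]

theorem stretch_zero : stretch α 0 = α 0 := stretch_val 0

@[simp] theorem mem_tasks {S : Finset ℕ} {t : Fin (n + 1)} : t ∈ tasks n S ↔ (t : ℕ) ∈ S := by
  simp [tasks]

theorem sum_stretch {S : Finset ℕ} (hS : S ⊆ Finset.Icc 1 n) :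
    ∑ t ∈ S, 3 * stretch α t = seq α (tasks n S) := by
  have e : S = (tasks n S).map Fin.valEmbedding := by
    ext t
    simp only [Finset.mem_map, mem_tasks, Fin.valEmbedding_apply]
    constructor
    · intro ht
      have := Finset.mem_Icc.1 (hS ht)
      exact ⟨⟨t, by omega⟩, ht, rfl⟩
    · rintro ⟨u, hu, rfl⟩
      exact hu
  conv_lhs => rw [e]
  simp [seq]

theorem exists_tasks {V : Finset (Fin (n + 1))} (hV : 0 ∉ V) :
    ∃ S ⊆ Finset.Icc 1 n, tasks n S = V := by
  refine ⟨V.map Fin.valEmbedding, fun t ht => ?_, ?_⟩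
  · obtain ⟨u, hu, rfl⟩ := Finset.mem_map.1 ht
    have : (u : ℕ) ≠ 0 := fun h => hV (by rwa [← Fin.val_eq_zero_iff.1 h])
    have := u.2
    simp only [Fin.valEmbedding_apply, Finset.mem_Icc]
    omega
  · ext t
    simp [Fin.val_inj]

theorem above_stretch {S : Finset ℕ} (hS : S ⊆ Finset.Icc 1 n) (t : Fin (n + 1)) :
    above (stretch α) S t = after α (tasks n S) t := by
  rw [above, sum_stretch ((Finset.filter_subset _ _).trans hS), after]
  congr 1
  ext u
  simp

theorem tasks_others {S : Finset ℕ} (r : Fin (n + 1)) :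
    tasks n (others n S r) = rest (tasks n S) r := by
  ext t
  have := t.2
  simp only [others, rest, mem_tasks, Finset.mem_filter, Finset.mem_Icc, Finset.mem_univ,
    true_and, ne_eq, Fin.ext_iff, Fin.val_zero]
  refine and_congr_left fun _ => ?_
  omega

theorem place_eq_twoStacks {S : Finset ℕ} (hS : S ⊆ Finset.Icc 1 n) (r : Fin (n + 1)) (B x : ℕ)
    {t : Fin (n + 1)} (ht : t ≠ 0) :
    place n (stretch α) S r B t = twoStacks α (tasks n S) r x B t := by
  have h : above (stretch α) (others n S r) t = after α (rest (tasks n S) r) t := by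
    rw [above_stretch (S := others n S r) (Finset.filter_subset _ _), tasks_others]
  simp only [place, twoStacks, ht, if_false, mem_tasks, above_stretch hS, h, stretch_zero,
    Fin.ext_iff]

theorem not_large_iff : (∀ t, 1 ≤ t → t ≤ n → ¬ Large (stretch α 0) (stretch α t)) ↔
    ∀ t : Fin (n + 1), t ≠ 0 → ¬ Large (α 0) (α t) := by
  rw [stretch_zero]
  constructor
  · intro h t ht
    have h1 : (t : ℕ) ≠ 0 := fun h => ht (Fin.val_eq_zero_iff.1 h)
    have := h t (by omega) (by omega)
    rwa [stretch_val] at this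
  · intro h t h1 h2
    have := h ⟨t, by omega⟩ (by simp [Fin.ext_iff]; omega)
    rwa [← stretch_val (α := α) ⟨t, by omega⟩] at this

/-- The output of the program is a `1 + p / q`-approximate schedule. -/
theorem IsSolution.isApproxSchedule {K p q : ℕ} {out : ℕ → ℕ} (pos : ∀ t, 0 < α t) (hq : 0 < q)
    (hK : (n + 1) * q ≤ K * p) (h : IsSolution n K (stretch α) out) :
    IsApproxSchedule (SimpleGraph.starGraph 0) α (1 + (p : ℝ) / q)
      (fun t : Fin (n + 1) => (out t : ℝ)) := by
  have hpq : (0 : ℝ) ≤ (p : ℝ) / q := by positivity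
  rcases h with ⟨S, hS, hno, hSa, hbest, h0, hout⟩ | ⟨r, hr1, hrn, hrL, hmax, h0, hout⟩
  · rw [stretch_zero] at hSa hbest
    rw [not_large_iff] at hno
    rw [sum_stretch hS] at hSa hbest
    have hW0 : 0 ∉ tasks n S := by
      rw [mem_tasks]
      intro h
      simpa using Finset.mem_Icc.1 (hS h)
    have e : (fun t : Fin (n + 1) => (out t : ℝ)) =
        fun t => (twoStacks α (tasks n S) 0 0 (3 * α 0) t : ℝ) := by
      funext t
      by_cases ht : t = 0
      · subst ht
        simp [h0, twoStacks]
      · have h1 : (t : ℕ) ≠ 0 := fun h => ht (Fin.val_eq_zero_iff.1 h)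
        rw [hout t (by omega) (by omega), ← place_eq_twoStacks hS 0 (3 * α 0) 0 ht, stretch_zero]
        rfl
    rw [e]
    refine ⟨twoStacks_feasible hSa, fun τ hτ => (twoStacks_makespan_le hW0 hSa).trans ?_⟩
    have hM : (α 0 : ℝ) ≤ makespan α τ := by
      have := le_makespan α τ 0
      have := hτ.1 0
      have : (0 : ℝ) ≤ α 0 := by positivity
      linarith
    rcases hτ.lower_bound pos with ⟨⟨t, ht, h⟩, -⟩ | ⟨⟨t, ht, h⟩, -⟩ | ⟨V, hV0, hV, hle⟩
    · exact absurd (.inr h) (hno t ht)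
    · exact absurd (.inl h) (hno t ht)
    · obtain ⟨V', hV', rfl⟩ := exists_tasks hV0
      have hb := hbest V' hV' (by rwa [sum_stretch hV'])
      rw [sum_stretch hV'] at hb
      have hb' : (K : ℝ) * seq α (tasks n V') ≤ K * seq α (tasks n S) + n * α 0 := by
        exact_mod_cast hb
      have hK' : ((n : ℝ) + 1) * q ≤ K * p := by exact_mod_cast hK
      have hq' : (0 : ℝ) < q := by exact_mod_cast hq
      -- The factor `n + 1` instead of `n` in the choice of `K` matters here: it keeps `K` positive
      -- even without satellites.
      have hKpos : (0 : ℝ) < K := by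
        rcases Nat.eq_zero_or_pos K with h | h
        · subst h
          have : 0 < (n + 1) * q := by positivity
          omega
        · exact_mod_cast h
      have h1 : ((n : ℝ) + 1) ≤ K * (p / q) := by
        rw [← mul_div_assoc, le_div_iff₀ hq']
        exact hK'
      have h2 : (n : ℝ) * α 0 ≤ K * (p / q) * α 0 :=
        mul_le_mul_of_nonneg_right (by linarith) (by positivity)
      have h3 : (seq α (tasks n V') : ℝ) ≤ seq α (tasks n S) + p / q * α 0 := by
        refine le_of_mul_le_mul_left ?_ hKpos
        calc (K : ℝ) * seq α (tasks n V') ≤ K * seq α (tasks n S) + K * (p / q) * α 0 := by linarith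
          _ = K * (seq α (tasks n S) + p / q * α 0) := by ring
      have h4 : (p : ℝ) / q * α 0 ≤ p / q * makespan α τ := mul_le_mul_of_nonneg_left hM hpq
      linarith
  · set s : Fin (n + 1) := ⟨r, by omega⟩ with hs
    have hs0 : s ≠ 0 := by simp [hs, Fin.ext_iff]; omega
    have hr : r = s := rfl
    simp only [hr, stretch_zero, stretch_val] at hrL hmax h0 hout
    set B := max (3 * α s) (α s + 3 * α 0) with hB
    have e : (fun t : Fin (n + 1) => (out t : ℝ)) =
        fun t => (twoStacks α ∅ s (α s) B t : ℝ) := by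
      funext t
      by_cases ht : t = 0
      · subst ht
        simp [h0, twoStacks]
      · have h1 : (t : ℕ) ≠ 0 := fun h => ht (Fin.val_eq_zero_iff.1 h)
        rw [hout t (by omega) (by omega), place_eq_twoStacks (by simp) s B (α s) ht,
          show tasks n ∅ = ∅ by simp [tasks]]
    rw [e]
    obtain ⟨hf, hm⟩ := twoStacks_special (α := α) hs0 hrL B (le_max_left _ _) (le_max_right _ _)
    refine ⟨hf, fun τ hτ => hm.trans ?_⟩
    have hM : 0 ≤ p / q * makespan α τ := mul_nonneg hpq (makespan_nonneg hτ)
    -- With a large satellite the schedule is optimal, so no `p / q` is needed.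
    suffices h : (seq α Finset.univ : ℝ) + B - 3 * α 0 - 3 * α s ≤ makespan α τ by linarith
    have ha : (0 : ℝ) ≤ α 0 := by positivity
    by_cases hbig : 3 * α 0 ≤ α s
    · have hB' : B = 3 * α s := by omega
      rw [hB']
      push_cast
      rcases hτ.lower_bound pos with ⟨-, h⟩ | ⟨-, h⟩ | ⟨V, -, hV, h⟩
      · linarith
      · linarith
      · have : (seq α V : ℝ) ≤ α 0 := by exact_mod_cast hV
        linarith
    -- By maximality of `s` no satellite can contain the central task, so at most `2 * α 0` can be
    -- saved. Interleaving saves exactly this: two tasks of length `3 * α 0` fit into `4 * α 0`.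
    · have heq : α s = α 0 := hrL.resolve_right hbig
      have hB' : B = 4 * α 0 := by omega
      rw [hB', heq]
      push_cast
      rcases hτ.lower_bound pos with ⟨⟨t, ht, h'⟩, -⟩ | ⟨-, h⟩ | ⟨V, -, hV, h⟩
      · have h1 : (t : ℕ) ≠ 0 := fun h => ht (Fin.val_eq_zero_iff.1 h)
        have := hmax t (by omega) (by omega)
        rw [stretch_val] at this
        have := this (.inr h')
        omega
      · linarith
      · have : (seq α V : ℝ) ≤ α 0 := by exact_mod_cast hV
        linarith

/-! ### The number of steps is polynomial in the input size and `q / p`. -/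

theorem le_bitLength (I : StarInstance) : I.n + 1 ≤ bitLength I.encode := by
  have h : ∀ w : List ℕ, w.length ≤ bitLength w := by
    intro w
    induction w with
    | nil => simp
    | cons x w ih =>
      simp only [bitLength, List.map_cons, List.sum_cons, List.length_cons] at ih ⊢
      omega
  have := h I.encode
  simp [StarInstance.encode] at this ⊢
  omega

theorem admitsFPTAS : starProblem.AdmitsFPTAS := by
  -- With `L` the input size plus `q / p`, both `n + 1` and `q / p` are at most `L`, and `1 ≤ L *
  -- L`. The bound of `program_spec` becomes `90 * L * (L * L + L * L) = 180 * L ^ 3`.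
  refine ⟨program, 180, 3, fun I p q hp hq => ?_⟩
  change StarInstance at I
  have hin : ∀ t ≤ I.n,
      (initial (p :: q :: starProblem.encode I)).arr 0 (3 + t) = stretch I.α t := by
    intro t ht
    have hlt : t < I.n + 1 := by omega
    simp only [initial, starProblem, StarInstance.encode, if_true, add_comm 3 t,
      List.getD_cons_succ]
    rw [List.getD_eq_getElem _ _ (by simpa using hlt), List.getElem_ofFn, stretch, dif_pos hlt]
  obtain ⟨s, T, hexec, hT, K, hK, hsol⟩ := program_spec (n := I.n) (q := q) (c := stretch I.α)
    (s := initial (p :: q :: starProblem.encode I)) hp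
    (by rw [stretch_zero]; exact I.pos 0) (fun _ => rfl) rfl rfl rfl hin
    (fun b l hb => by simp [initial, hb])
  refine ⟨s, T, hexec, ?_, hsol.isApproxSchedule I.pos hq hK⟩
  have hp' : (0 : ℝ) < p := by exact_mod_cast hp
  set L : ℝ := (bitLength (starProblem.encode I) : ℝ) + (q : ℝ) / p with hL
  have hqp : (0 : ℝ) ≤ (q : ℝ) / p := by positivity
  have hn : (I.n : ℝ) + 1 ≤ L := by
    have : ((I.n + 1 : ℕ) : ℝ) ≤ bitLength (starProblem.encode I) := by
      exact_mod_cast le_bitLength I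
    push_cast at this
    linarith
  have hn0 : (0 : ℝ) ≤ I.n := by positivity
  have hqL : (q : ℝ) / p ≤ L := by
    have : (0 : ℝ) ≤ bitLength (starProblem.encode I) := by positivity
    linarith
  have hdiv : (((I.n + 1) * q / p : ℕ) : ℝ) ≤ L * L := by
    refine Nat.cast_div_le.trans ?_
    push_cast
    rw [mul_div_assoc]
    exact mul_le_mul hn hqL hqp (by linarith)
  have h1 : (1 : ℝ) ≤ L * L := by nlinarith
  calc (T : ℝ) ≤ ((90 * ((I.n + 1) * ((I.n + 1) * q / p + 1)) : ℕ) : ℝ) := by exact_mod_cast hT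
    _ = 90 * (((I.n : ℝ) + 1) * ((((I.n + 1) * q / p : ℕ) : ℝ) + 1)) := by push_cast; ring
    _ ≤ 90 * (L * (L * L + L * L)) := by gcongr
    _ = (180 : ℕ) * L ^ 3 := by push_cast; ring

end StarFPTAS

theorem theorem4p1 :
    CoupledTask.starProblem.AdmitsFPTAS ∧
    ∀ I : CoupledTask.StarInstance, I.OnlyIncoming →
      (∀ W : Finset (Fin (I.n + 1)),
        SubsetSum.Feasible (Finset.univ.erase 0) (fun t => 3 * I.α t) (I.α 0) W →
          3 * CoupledTask.seq I.α W ≤ CoupledTask.seq I.α Finset.univ) ∧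
      ∀ (ε : ℝ) (W : Finset (Fin (I.n + 1))), 0 ≤ ε →
        SubsetSum.IsApprox (Finset.univ.erase 0) (fun t => 3 * I.α t) (I.α 0) (1 - ε) W →
          ∃ σ : Fin (I.n + 1) → ℝ,
            (∀ t, t ∈ W ↔ CoupledTask.span I.α σ t ⊆ CoupledTask.idle I.α σ 0) ∧
            CoupledTask.makespan I.α σ =
              (CoupledTask.seq I.α Finset.univ : ℝ) - CoupledTask.seq I.α W ∧
            CoupledTask.IsApproxSchedule (SimpleGraph.starGraph 0) I.α (1 + ε / 2) σ := by
  refine ⟨StarFPTAS.admitsFPTAS, fun I hI => ⟨fun W hW => ?_, fun ε W hε hW => ?_⟩⟩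
  · rw [CoupledTask.subsetSum_feasible_iff] at hW
    exact CoupledTask.three_mul_seq_le hW.1 hW.2
  · have hf := CoupledTask.subsetSum_feasible_iff.1 hW.1
    exact ⟨_, CoupledTask.twoStacks_mem_iff I.pos hf.1 hf.2,
      CoupledTask.twoStacks_makespan hf.1 hf.2, CoupledTask.twoStacks_isApprox I.pos hI hε hW⟩
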